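/- **Setting.** There are $I\ge 2$ endowment states with shares of the young $0<s(1)<\dots<s(I)<1$, drawn i.i.d. over time with probabilities $\pi(r)>0$, $\sum_r\pi(r)=1$. Let $\beta\in(0,1]$, $\delta\in(0,1)$. An insurance rule assigns to every history $s^t=(s_0,\dots,s_t)$ a consumption share $c(s^t)>0$ of the young. It is *sustainable* from $s_0$ if for all histories starting in $s_0$ $$c(s^t)\le s_t,\qquad \log c(s^t)-\log s_t+\beta\sum_r\pi(r)\bigl(\log(1-c(s^t,r))-\log(1-r)\bigr)\ge 0 ,$$ where the sum is over the endowment shares $r$ of the next period. For a state $s$ let $\omega_{\min}(s)=\log(1-s)$, let $\omega_{\max}(s)$ be the largest value of $\log(1-c(s_0))$ over rules sustainable from $s_0=s$, and let $V(s,\omega)$ be the planner's value function, i.e. the maximum of $$\mathbb E\Bigl[\sum_{t\ge0}\delta^t\bigl(\tfrac{\beta}{\delta}\log(1-c(s^t))+\log c(s^t)\bigr)\,\Big|\,s_0=s\Bigr]$$ over the rules sustainable from $s$ with $\log(1-c(s_0))\ge\omega$. Let $c^*(s)=\min\{\delta/(\beta+\delta),s\}$, $\omega^*(s)=\max\{\omega_{\min}(s),\log(\beta/(\beta+\delta))\}$,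 $\Omega(s)=[\omega_{\min}(s),\omega_{\max}(s)]$, and let $V_\omega$ be the derivative in $\omega$ (one-sided at the endpoints of $\Omega(s)$). **Assumptions.** (a) $\sum_{s}\pi(s)\,\beta s/(1-s)>1$; (b) $s(1)\le\delta/(\beta+\delta)$; (c) $\log c^*(s(I))+\beta\sum_r\pi(r)\log(1-c^*(r))<\log s(I)+\beta\sum_r\pi(r)\log(1-r)$. **Lemma.** (i) For each state $s$, $\omega_{\min}(s)<\omega_{\max}(s)$, and $V(s,\cdot)$ is nonincreasing, concave and continuous on $\Omega(s)$ and continuously differentiable on $[\omega_{\min}(s),\omega_{\max}(s))$. (ii) For each state $s$ there is $\omega^0(s)\in[\omega_{\min}(s),\omega^*(s)]$, with $\omega^0(s)<\omega_{\max}(s)$, such that $V(s,\cdot)$ is strictly decreasing and strictly concave on $(\omega^0(s),\omega_{\max}(s)]$. If $\omega^*(s)>\omega_{\min}(s)$, then $\omega^0(s)>\omega_{\min}(s)$ and $V_\omega(s,\omega)=0$ for $\omega\in[\omega_{\min}(s),\omega^0(s)]$; and for at least one state with $\omega^*(s)>\omega_{\min}(s)$, $\omega^0(s)<\omega^*(s)$.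 If $\omega^*(s)=\omega_{\min}(s)$, then $\omega^0(s)=\omega^*(s)$ and $V_\omega(s,\omega^0(s))\le \beta/\delta-(1-s)/s\le 0$. In either case $\lim_{\omega\uparrow\omega_{\max}(s)}V_\omega(s,\omega)=-(\beta/\delta)\lambda_{\max}(s)$ for some $\lambda_{\max}(s)\in\mathbb R_+\cup\{\infty\}$. (iii) $\omega_{\max}(s)<0$ for every state, $\omega_{\max}(s(i))<\omega_{\max}(s(i-1))$ for $i=2,\dots,I$, and $\omega^0(s(i))\le\omega^0(s(i-1))$ for $i=2,\dots,I$, with strict inequality for at least one $i$. -/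

import Mathlib

open Set Filter Topology
open scoped ENNReal

/-- Primitives of the overlapping generations economy with `n + 2` (i.e. at least two) endowment
states, in consumption shares. States are i.i.d. over time with law `prob`; they are ordered so
that a higher state has a larger endowment share of the young. -/
structure Economy (n : ℕ) where
  /-- endowment share of the young in each state -/
  share : Fin (n + 2) → ℝ
  share_pos : ∀ i, 0 < share i
  share_lt_one : ∀ i, share i < 1
  share_strictMono : StrictMono share
  /-- probability of each state -/
  prob : Fin (n + 2) → ℝ
  prob_pos : ∀ i, 0 < prob i
  prob_sum : ∑ i, prob i = 1
  /-- generational discount factor -/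
  β : ℝ
  β_pos : 0 < β
  β_le_one : β ≤ 1
  /-- the planner's discount factor -/
  δ : ℝ
  δ_pos : 0 < δ
  δ_lt_one : δ < 1

namespace Economy

variable {n : ℕ}

/-- An intergenerational insurance rule: the consumption share of the young after each history
`(s_0, …, s_t)` of states. -/
abbrev Rule (n : ℕ) : Type := (t : ℕ) → (Fin (t + 1) → Fin (n + 2)) → ℝ

/-- Lifetime utility gain over autarky of the generation born after the history `h`. -/
noncomputable def gain (E : Economy n) (c : Rule n) (t : ℕ) (h : Fin (t + 1) → Fin (n + 2)) : ℝ :=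
  Real.log (c t h) - Real.log (E.share (h (Fin.last t)))
    + E.β * ∑ r, E.prob r *
        (Real.log (1 - c (t + 1) (Fin.snoc (α := fun _ => Fin (n + 2)) h r))
          - Real.log (1 - E.share r))

/-- The rule `c` is sustainable from the initial state `s₀`: after every history starting in `s₀`
the consumption share of the young is positive, the old make no transfer to the young, and the
young are no worse off than in autarky. -/
def Sustainable (E : Economy n) (s₀ : Fin (n + 2)) (c : Rule n) : Prop :=
  ∀ (t : ℕ) (h : Fin (t + 1) → Fin (n + 2)), h 0 = s₀ →
    0 < c t h ∧ c t h ≤ E.share (h (Fin.last t)) ∧ 0 ≤ E.gain c t h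

/-- The planner's payoff in a period in which the young consume the share `x`. -/
noncomputable def periodPayoff (E : Economy n) (x : ℝ) : ℝ :=
  E.β / E.δ * Real.log (1 - x) + Real.log x

/-- The planner's expected discounted payoff from the rule `c` when the initial state is `s₀`.
The date-`t` expectation is the sum over the states `(s_1, …, s_t)` that follow `s₀`. -/
noncomputable def payoff (E : Economy n) (s₀ : Fin (n + 2)) (c : Rule n) : ℝ :=
  ∑' t : ℕ, E.δ ^ t * ∑ h : Fin t → Fin (n + 2),
    (∏ k, E.prob (h k)) *
      E.periodPayoff (c t (Fin.cons (α := fun _ => Fin (n + 2)) s₀ h))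

/-- Utility of the old under the rule `c` at the initial date in the initial state `s₀`. -/
noncomputable def initialOld (s₀ : Fin (n + 2)) (c : Rule n) : ℝ :=
  Real.log (1 - c 0 (fun _ => s₀))

/-- The planner's value function: the optimal payoff over the sustainable rules that give the
initial old at least the promised utility `ω`. -/
noncomputable def V (E : Economy n) (s : Fin (n + 2)) (ω : ℝ) : ℝ :=
  sSup {v | ∃ c : Rule n, E.Sustainable s c ∧ ω ≤ initialOld s c ∧ v = E.payoff s c}

/-- Autarkic utility of the old, the smallest promise. -/
noncomputable def ωmin (E : Economy n) (s : Fin (n + 2)) : ℝ := Real.log (1 - E.share s)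

/-- The largest promise to the old that a sustainable rule can deliver. -/
noncomputable def ωmax (E : Economy n) (s : Fin (n + 2)) : ℝ :=
  sSup {ω | ∃ c : Rule n, E.Sustainable s c ∧ ω = initialOld s c}

/-- The interval of feasible promises. -/
def Ω (E : Economy n) (s : Fin (n + 2)) : Set ℝ := Icc (E.ωmin s) (E.ωmax s)

/-- The derivative of the value function in the promise, one-sided at the endpoints of `Ω s`. -/
noncomputable def Vω (E : Economy n) (s : Fin (n + 2)) (ω : ℝ) : ℝ :=
  derivWithin (E.V s) (E.Ω s) ω

/-- First-best consumption share of the young. -/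
noncomputable def cstar (E : Economy n) (s : Fin (n + 2)) : ℝ :=
  min (E.δ / (E.β + E.δ)) (E.share s)

/-- First-best utility of the old. -/
noncomputable def ωstar (E : Economy n) (s : Fin (n + 2)) : ℝ :=
  max (E.ωmin s) (Real.log (E.β / (E.β + E.δ)))

/-- Autarky state price `q̂(s, r) = π(r) β s / (1 - r)`. -/
noncomputable def autarkyPrice (E : Economy n) (s r : Fin (n + 2)) : ℝ :=
  E.prob r * (E.β * E.share s / (1 - E.share r))

/-- The trace (the Perron root) of the matrix of autarky state prices exceeds one. -/
def PerronRootGtOne (E : Economy n) : Prop := 1 < ∑ s, E.autarkyPrice s s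

/-- In the lowest state the endowment share of the young is at most `δ / (β + δ)`. -/
def LowestShareLe (E : Economy n) : Prop := E.share 0 ≤ E.δ / (E.β + E.δ)

/-- The first best violates the participation constraint of the young in the highest state. -/
def FirstBestNotSustainable (E : Economy n) : Prop :=
  Real.log (E.cstar (Fin.last (n + 1))) + E.β * ∑ r, E.prob r * Real.log (1 - E.cstar r)
    < Real.log (E.share (Fin.last (n + 1))) + E.β * ∑ r, E.prob r * Real.log (1 - E.share r)

end Economy

/-! Describe a rule by its wedges k = log s - log c ≥ 0, the utility that the young give up.
Participation then reads k ≤ `reward` κ, where κ collects the wedges one period later: the current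
state drops out, and `reward` is monotone and concave. In every state the attainable wedges
therefore form the same interval [0, K], with K = `maxWedge` the largest fixed point of `reward` on
constant wedges. Assumption (a) says that this one-variable map has slope above 1 at 0, so K > 0. As
states are i.i.d., the optimal payoff at wedge k is `flow` s k + δ `G` k with a single nonincreasing
concave function `G`, and V(s, ·) is the nonincreasing envelope of a strictly concave function of
the promise.

The hard point is that `G` has no kink on [0, K). With multiplier m - 1 on the reward constraint,
the problem defining `G` splits by state; its maximizers `policy r m` sustain the wedge `total m`,
and a kink of `G` would be an interval of weights on which `total` is constant. The first-order
condition in state r says that the weight `next r m` = m · `growth` supports the wedge `policy r m`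
in `G` again. A flat from m to R m is thus carried to a flat of the same ratio R by every state with
a positive wedge.

Suppose there is a flat. The lowest state lowers weights, by (b), so every ratio that occurs also
occurs in a bounded range, and a maximal ratio R exists. Flats of ratio R start more than a factor R
apart. The highest state moves each of them strictly up, by (c), so they occur arbitrarily far out.
There the wedges approach K and the growth factors converge, so the moves by the highest and the
lowest state in either order end within a factor R of each other, hence at the same point; the
strict monotonicity of the growth factors forbids this (`flats_eq_empty_of_maximal`).

Without flats the supporting weight depends continuously on the wedge, and a continuous selection of
supergradients is a derivative. The threshold ω⁰ is `peak`, the promise made at weight 1; its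
properties follow by comparing weights with 1 and across states. -/

/-! ### The utility frontier between young and old -/

/-- The utility `log (1 - c)` of the old as a function of the utility `y = log c` of the young. -/
noncomputable def logCompl (y : ℝ) : ℝ := Real.log (1 - Real.exp y)

/-- The odds `c / (1 - c)` as a function of `y = log c`. -/
noncomputable def odds (y : ℝ) : ℝ := Real.exp y / (1 - Real.exp y)

theorem one_sub_exp_pos {y : ℝ} (hy : y < 0) : 0 < 1 - Real.exp y :=
  sub_pos.2 (Real.exp_zero ▸ Real.exp_lt_exp.2 hy)

theorem exp_logCompl {y : ℝ} (hy : y < 0) : Real.exp (logCompl y) = 1 - Real.exp y :=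
  Real.exp_log (one_sub_exp_pos hy)

/-- The exchange c ↔ 1 - c is an involution, so one function converts utilities in both directions.
-/
theorem logCompl_logCompl {y : ℝ} (hy : y < 0) : logCompl (logCompl y) = y := by
  rw [logCompl, exp_logCompl hy, sub_sub_cancel, Real.log_exp]

theorem logCompl_neg {y : ℝ} (hy : y < 0) : logCompl y < 0 :=
  Real.log_neg (one_sub_exp_pos hy) (by linarith [Real.exp_pos y])

theorem odds_pos {y : ℝ} (hy : y < 0) : 0 < odds y :=
  div_pos (Real.exp_pos y) (one_sub_exp_pos hy)

theorem odds_logCompl {y : ℝ} (hy : y < 0) : odds (logCompl y) = (odds y)⁻¹ := by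
  rw [odds, odds, exp_logCompl hy, sub_sub_cancel, inv_div]

theorem odds_strictMonoOn : StrictMonoOn odds (Iio 0) := by
  intro a ha b hb hab
  have h := Real.exp_lt_exp.2 hab
  have h1 := one_sub_exp_pos ha
  have h2 := one_sub_exp_pos hb
  rw [odds, odds, div_lt_div_iff₀ h1 h2]
  nlinarith

theorem continuousOn_odds : ContinuousOn odds (Iio 0) := by
  apply ContinuousOn.div (by fun_prop) (by fun_prop)
  intro y hy
  exact (one_sub_exp_pos hy).ne'

theorem hasDerivAt_logCompl {y : ℝ} (hy : y < 0) : HasDerivAt logCompl (-odds y) y := by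
  have h := ((Real.hasDerivAt_exp y).const_sub 1).log (one_sub_exp_pos hy).ne'
  rwa [neg_div] at h

theorem continuousOn_logCompl : ContinuousOn logCompl (Iio 0) := fun _ hy =>
  (hasDerivAt_logCompl hy).continuousAt.continuousWithinAt

theorem logCompl_strictAntiOn : StrictAntiOn logCompl (Iio 0) := by
  intro a ha b hb hab
  exact Real.log_lt_log (one_sub_exp_pos hb) (by linarith [Real.exp_lt_exp.2 hab])

theorem logCompl_strictConcaveOn : StrictConcaveOn ℝ (Iio 0) logCompl := by
  apply StrictAntiOn.strictConcaveOn_of_deriv (convex_Iio 0) continuousOn_logCompl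
  rw [interior_Iio]
  intro a ha b hb hab
  rw [(hasDerivAt_logCompl ha).deriv, (hasDerivAt_logCompl hb).deriv]
  exact neg_lt_neg (odds_strictMonoOn ha hb hab)

/-- A concave function lies below its tangents. -/
theorem ConcaveOn.le_tangent {S : Set ℝ} {f : ℝ → ℝ} {f' x y : ℝ} (hf : ConcaveOn ℝ S f)
    (hx : x ∈ S) (hy : y ∈ S) (hd : HasDerivAt f f' x) : f y ≤ f x + f' * (y - x) := by
  rcases lt_trichotomy x y with h | h | h
  · have := hf.slope_le_of_hasDerivAt hx hy h hd
    rw [slope_def_field, div_le_iff₀ (sub_pos.2 h)] at this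
    linarith
  · subst h; simp
  · have := hf.le_slope_of_hasDerivAt hy hx h hd
    rw [slope_def_field, le_div_iff₀ (sub_pos.2 h)] at this
    linarith

theorem logCompl_le_tangent {y z : ℝ} (hy : y < 0) (hz : z < 0) :
    logCompl z ≤ logCompl y - odds y * (z - y) := by
  have := logCompl_strictConcaveOn.concaveOn.le_tangent hy hz (hasDerivAt_logCompl hy)
  linarith

/-! ### Wedges and the reward for giving them up -/

namespace Economy

variable {n : ℕ} (E : Economy n)

/-- Autarkic utility of the young. -/
noncomputable def logShare (s : Fin (n + 2)) : ℝ := Real.log (E.share s)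

theorem logShare_neg (s : Fin (n + 2)) : E.logShare s < 0 :=
  Real.log_neg (E.share_pos s) (E.share_lt_one s)

theorem exp_logShare (s : Fin (n + 2)) : Real.exp (E.logShare s) = E.share s :=
  Real.exp_log (E.share_pos s)

theorem logShare_strictMono : StrictMono E.logShare := fun _ _ h =>
  Real.log_lt_log (E.share_pos _) (E.share_strictMono h)

theorem logShare_sub_neg (s : Fin (n + 2)) {k : ℝ} (hk : 0 ≤ k) : E.logShare s - k < 0 := by
  linarith [E.logShare_neg s]

/-- Utility of the old in state `s` when the young, giving up `k` utils relative to autarky,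
consume the share `share s * exp (-k)`. -/
noncomputable def W (s : Fin (n + 2)) (k : ℝ) : ℝ := logCompl (E.logShare s - k)

theorem W_zero (s : Fin (n + 2)) : E.W s 0 = E.ωmin s := by
  rw [W, sub_zero, logCompl, exp_logShare, ωmin]

theorem W_strictMonoOn (s : Fin (n + 2)) : StrictMonoOn (E.W s) (Ici 0) := fun _ ha _ hb hab =>
  logCompl_strictAntiOn (E.logShare_sub_neg s hb) (E.logShare_sub_neg s ha) (by linarith)

theorem W_monotoneOn (s : Fin (n + 2)) : MonotoneOn (E.W s) (Ici 0) :=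
  (E.W_strictMonoOn s).monotoneOn

theorem W_neg (s : Fin (n + 2)) {k : ℝ} (hk : 0 ≤ k) : E.W s k < 0 :=
  logCompl_neg (E.logShare_sub_neg s hk)

theorem hasDerivAt_W (s : Fin (n + 2)) {k : ℝ} (hk : 0 ≤ k) :
    HasDerivAt (E.W s) (odds (E.logShare s - k)) k := by
  have h := (hasDerivAt_logCompl (E.logShare_sub_neg s hk)).comp k
    ((hasDerivAt_id k).const_sub (E.logShare s))
  rwa [mul_neg, mul_one, neg_neg] at h

theorem continuousOn_W (s : Fin (n + 2)) : ContinuousOn (E.W s) (Ici 0) := fun _ hk =>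
  (E.hasDerivAt_W s hk).continuousAt.continuousWithinAt

theorem W_strictConcaveOn (s : Fin (n + 2)) : StrictConcaveOn ℝ (Ici 0) (E.W s) := by
  refine ⟨convex_Ici 0, fun x hx y hy hxy a b ha hb hab => ?_⟩
  have h := logCompl_strictConcaveOn.2 (E.logShare_sub_neg s hx) (E.logShare_sub_neg s hy)
    (by intro h; apply hxy; linarith) ha hb hab
  have e : a • (E.logShare s - x) + b • (E.logShare s - y) =
      E.logShare s - (a • x + b • y) := by
    simp only [smul_eq_mul]; linear_combination (E.logShare s) * hab
  rw [e] at h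
  exact h

/-- Expected discounted gain of the young from next period's transfers when they give up the
wedges `κ`. -/
noncomputable def reward (κ : Fin (n + 2) → ℝ) : ℝ :=
  E.β * ∑ r, E.prob r * (E.W r (κ r) - E.W r 0)

theorem reward_mono {κ κ' : Fin (n + 2) → ℝ} (h0 : ∀ r, 0 ≤ κ r) (h : ∀ r, κ r ≤ κ' r) :
    E.reward κ ≤ E.reward κ' := by
  refine mul_le_mul_of_nonneg_left (Finset.sum_le_sum fun r _ => ?_) E.β_pos.le
  refine mul_le_mul_of_nonneg_left ?_ (E.prob_pos r).le
  have := E.W_monotoneOn r (h0 r) ((h0 r).trans (h r) : 0 ≤ κ' r) (h r)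
  linarith

/-- Every state has positive probability and each `W r` is strictly increasing, so a larger vector
of wedges with no larger reward is the same vector. -/
theorem eq_of_reward_le {κ κ' : Fin (n + 2) → ℝ} (h0 : ∀ r, 0 ≤ κ r) (h : ∀ r, κ r ≤ κ' r)
    (hle : E.reward κ' ≤ E.reward κ) (r : Fin (n + 2)) : κ r = κ' r := by
  by_contra hne
  have hlt : κ r < κ' r := lt_of_le_of_ne (h r) hne
  refine hle.not_gt (mul_lt_mul_of_pos_left (Finset.sum_lt_sum (fun r _ => ?_)
    ⟨r, Finset.mem_univ r, ?_⟩) E.β_pos)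
  · refine mul_le_mul_of_nonneg_left ?_ (E.prob_pos r).le
    have := E.W_monotoneOn r (h0 r) ((h0 r).trans (h r) : 0 ≤ κ' r) (h r)
    linarith
  · refine mul_lt_mul_of_pos_left ?_ (E.prob_pos r)
    have := E.W_strictMonoOn r (h0 r) ((h0 r).trans (h r) : 0 ≤ κ' r) hlt
    linarith

theorem reward_zero : E.reward (fun _ => 0) = 0 := by simp [reward]

theorem reward_nonneg {κ : Fin (n + 2) → ℝ} (h0 : ∀ r, 0 ≤ κ r) : 0 ≤ E.reward κ := by
  rw [← E.reward_zero]
  exact E.reward_mono (fun _ => le_rfl) h0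

theorem reward_le {κ : Fin (n + 2) → ℝ} (h0 : ∀ r, 0 ≤ κ r) :
    E.reward κ ≤ E.β * ∑ r, E.prob r * (-E.W r 0) := by
  refine mul_le_mul_of_nonneg_left (Finset.sum_le_sum fun r _ => ?_) E.β_pos.le
  refine mul_le_mul_of_nonneg_left ?_ (E.prob_pos r).le
  linarith [E.W_neg r (h0 r)]

theorem reward_concave {κ κ' : Fin (n + 2) → ℝ} (h : ∀ r, 0 ≤ κ r) (h' : ∀ r, 0 ≤ κ' r)
    {a b : ℝ} (ha : 0 ≤ a) (hb : 0 ≤ b) (hab : a + b = 1) :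
    a * E.reward κ + b * E.reward κ' ≤ E.reward (fun r => a * κ r + b * κ' r) := by
  have e : a * E.reward κ + b * E.reward κ' =
      E.β * ∑ r, E.prob r * (a * E.W r (κ r) + b * E.W r (κ' r) - E.W r 0) := by
    simp only [reward, ← mul_assoc, mul_comm _ E.β]
    rw [mul_assoc, mul_assoc, ← mul_add, Finset.mul_sum, Finset.mul_sum, ← Finset.sum_add_distrib]
    congr 1
    refine Finset.sum_congr rfl fun r _ => ?_
    linear_combination (-E.prob r * E.W r 0) * hab
  rw [e]
  refine mul_le_mul_of_nonneg_left (Finset.sum_le_sum fun r _ => ?_) E.β_pos.le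
  refine mul_le_mul_of_nonneg_left ?_ (E.prob_pos r).le
  have := (E.W_strictConcaveOn r).concaveOn.2 (h r) (h' r) ha hb hab
  simp only [smul_eq_mul] at this
  linarith

theorem continuousOn_reward : ContinuousOn E.reward {κ | ∀ r, 0 ≤ κ r} := by
  refine continuousOn_const.mul (continuousOn_finsetSum _ fun r _ => continuousOn_const.mul
    (ContinuousOn.sub ?_ continuousOn_const))
  exact (E.continuousOn_W r).comp (continuous_apply r).continuousOn fun κ hκ => hκ r

/-- The largest wedge in any sustainable rule. -/
noncomputable def maxWedge : ℝ := sSup {k | 0 ≤ k ∧ k ≤ E.reward fun _ => k}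

theorem bddAbove_wedges : BddAbove {k | 0 ≤ k ∧ k ≤ E.reward fun _ => k} :=
  ⟨_, fun _ hk => hk.2.trans (E.reward_le fun _ => hk.1)⟩

theorem le_maxWedge {k : ℝ} (h0 : 0 ≤ k) (h : k ≤ E.reward fun _ => k) : k ≤ E.maxWedge :=
  le_csSup E.bddAbove_wedges ⟨h0, h⟩

theorem maxWedge_nonneg : 0 ≤ E.maxWedge := E.le_maxWedge le_rfl E.reward_zero.ge

/-- The supremum of the k below their own reward is a fixed point, by monotonicity, as in Tarski's
theorem; continuity is not needed. -/
theorem reward_maxWedge : E.reward (fun _ => E.maxWedge) = E.maxWedge := by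
  have h1 : E.maxWedge ≤ E.reward fun _ => E.maxWedge := by
    refine csSup_le ⟨0, le_rfl, E.reward_zero.ge⟩ fun k hk => hk.2.trans ?_
    exact E.reward_mono (fun _ => hk.1) fun _ => E.le_maxWedge hk.1 hk.2
  refine le_antisymm (E.le_maxWedge (E.maxWedge_nonneg.trans h1) ?_) h1
  exact E.reward_mono (fun _ => E.maxWedge_nonneg) fun _ => h1

theorem reward_le_maxWedge {κ : Fin (n + 2) → ℝ} (h : ∀ r, κ r ∈ Icc 0 E.maxWedge) :
    E.reward κ ≤ E.maxWedge :=
  (E.reward_mono (fun r => (h r).1) fun r => (h r).2).trans_eq E.reward_maxWedge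

/-- The derivative of `reward` along constant wedges at 0 is the trace in (a). As it exceeds 1, some
small positive constant wedge is below its own reward. -/
theorem maxWedge_pos (hQ : E.PerronRootGtOne) : 0 < E.maxWedge := by
  have hd : HasDerivAt (fun k => E.reward fun _ => k) (∑ s, E.autarkyPrice s s) 0 := by
    have h : HasDerivAt (fun k => E.reward fun _ => k)
        (E.β * ∑ r, E.prob r * odds (E.logShare r - 0)) 0 := by
      refine HasDerivAt.const_mul _ (HasDerivAt.fun_sum fun r _ => HasDerivAt.const_mul _ ?_)
      exact (E.hasDerivAt_W r le_rfl).sub_const _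
    convert h using 1
    rw [Finset.mul_sum]
    refine Finset.sum_congr rfl fun r _ => ?_
    rw [autarkyPrice, odds, sub_zero, exp_logShare]
    ring
  have hev : ∀ᶠ k in 𝓝[>] (0 : ℝ), 1 < slope (fun k => E.reward fun _ => k) 0 k :=
    (hasDerivAt_iff_tendsto_slope.1 hd).mono_left (nhdsWithin_mono _ fun x hx => ne_of_gt hx)
      |>.eventually (lt_mem_nhds hQ)
  obtain ⟨k, hk, hk0⟩ := (hev.and self_mem_nhdsWithin).exists
  have hk0 : 0 < k := hk0
  rw [slope_def_field, E.reward_zero, lt_div_iff₀ (by linarith)] at hk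
  exact hk0.trans_le (E.le_maxWedge hk0.le (by linarith))

/-! ### First-best wedges -/

/-- Utility of the young in the first best without the participation constraint of the old. -/
noncomputable def logStar : ℝ := Real.log (E.δ / (E.β + E.δ))

theorem logStar_neg : E.logStar < 0 := by
  have := E.β_pos; have := E.δ_pos
  exact Real.log_neg (by positivity) ((div_lt_one (by positivity)).2 (by linarith))

theorem exp_logStar : Real.exp E.logStar = E.δ / (E.β + E.δ) := by
  have := E.β_pos; have := E.δ_pos
  exact Real.exp_log (by positivity)

theorem odds_logStar : odds E.logStar = E.δ / E.β := by
  have := E.β_pos; have := E.δ_pos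
  rw [odds, exp_logStar]
  rw [div_eq_div_iff (by rw [sub_ne_zero]; exact ((div_lt_one (by positivity)).2 (by linarith)).ne')
    (by positivity)]
  field_simp
  ring

theorem logCompl_logStar : logCompl E.logStar = Real.log (E.β / (E.β + E.δ)) := by
  have := E.β_pos; have := E.δ_pos
  rw [logCompl, exp_logStar]
  congr 1
  field_simp
  ring

/-- First-best wedge. -/
noncomputable def starWedge (s : Fin (n + 2)) : ℝ := max 0 (E.logShare s - E.logStar)

theorem starWedge_nonneg (s : Fin (n + 2)) : 0 ≤ E.starWedge s := le_max_left _ _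

theorem logShare_sub_starWedge (s : Fin (n + 2)) :
    E.logShare s - E.starWedge s = min E.logStar (E.logShare s) := by
  rw [starWedge]
  rcases le_total (E.logShare s) E.logStar with h | h
  · rw [max_eq_left (by linarith), min_eq_right h, sub_zero]
  · rw [max_eq_right (by linarith), min_eq_left h]; ring

theorem ωstar_eq (s : Fin (n + 2)) : E.ωstar s = E.W s (E.starWedge s) := by
  rw [W, logShare_sub_starWedge, ωstar, ← W_zero, W, sub_zero, ← logCompl_logStar]
  rcases le_total (E.logShare s) E.logStar with h | h
  · rw [min_eq_right h, max_eq_left]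
    exact logCompl_strictAntiOn.antitoneOn (E.logShare_neg s) E.logStar_neg h
  · rw [min_eq_left h, max_eq_right]
    exact logCompl_strictAntiOn.antitoneOn E.logStar_neg (E.logShare_neg s) h

theorem cstar_eq (s : Fin (n + 2)) :
    E.cstar s = Real.exp (E.logShare s - E.starWedge s) := by
  rw [logShare_sub_starWedge, cstar, Real.exp_monotone.map_min, exp_logShare, exp_logStar]

/-- This is assumption (c) in wedges. -/
theorem reward_starWedge_lt (hFB : E.FirstBestNotSustainable) :
    E.reward E.starWedge < E.starWedge (Fin.last (n + 1)) := by
  rw [FirstBestNotSustainable] at hFB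
  have e1 : ∀ r, Real.log (1 - E.cstar r) = E.W r (E.starWedge r) := fun r => by
    rw [cstar_eq]; rfl
  have e2 : ∀ r, Real.log (1 - E.share r) = E.W r 0 := fun r => (E.W_zero r).symm
  simp only [e1, e2] at hFB
  rw [cstar_eq, Real.log_exp] at hFB
  simp only [reward, mul_sub, Finset.sum_sub_distrib] at hFB ⊢
  have : Real.log (E.share (Fin.last (n + 1))) = E.logShare (Fin.last (n + 1)) := rfl
  linarith

theorem logShare_last_gt (hFB : E.FirstBestNotSustainable) :
    E.logStar < E.logShare (Fin.last (n + 1)) := by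
  have h := (E.reward_nonneg E.starWedge_nonneg).trans_lt (E.reward_starWedge_lt hFB)
  by_contra hle
  rw [starWedge, max_eq_left (by linarith)] at h
  exact lt_irrefl _ h

theorem logShare_zero_le (hLow : E.LowestShareLe) : E.logShare 0 ≤ E.logStar :=
  Real.log_le_log (E.share_pos 0) hLow

/-! ### Sustainable rules in terms of wedges -/

/-- The utility that the young give up after the history `h`, relative to autarky. -/
noncomputable def wedge (c : Rule n) (t : ℕ) (h : Fin (t + 1) → Fin (n + 2)) : ℝ :=
  E.logShare (h (Fin.last t)) - Real.log (c t h)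

/-- The history `h` followed by the state `r`. -/
abbrev extend {t : ℕ} (h : Fin t → Fin (n + 2)) (r : Fin (n + 2)) : Fin (t + 1) → Fin (n + 2) :=
  Fin.snoc (α := fun _ => Fin (n + 2)) h r

/-- The history `h` preceded by the state `s`. -/
abbrev precede {t : ℕ} (s : Fin (n + 2)) (h : Fin t → Fin (n + 2)) : Fin (t + 1) → Fin (n + 2) :=
  Fin.cons (α := fun _ => Fin (n + 2)) s h

theorem extend_apply_zero {t : ℕ} (h : Fin (t + 1) → Fin (n + 2)) (r : Fin (n + 2)) :
    extend h r 0 = h 0 := by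
  rw [← Fin.castSucc_zero]
  exact Fin.snoc_castSucc (α := fun _ => Fin (n + 2)) r h 0

theorem extend_last {t : ℕ} (h : Fin t → Fin (n + 2)) (r : Fin (n + 2)) :
    extend h r (Fin.last t) = r := Fin.snoc_last (α := fun _ => Fin (n + 2)) r h

theorem extend_precede {t : ℕ} (s : Fin (n + 2)) (h : Fin t → Fin (n + 2)) (r : Fin (n + 2)) :
    extend (precede s h) r = precede s (extend h r) :=
  (Fin.cons_snoc_eq_snoc_cons s h r).symm

theorem precede_last {t : ℕ} (s : Fin (n + 2)) (h : Fin (t + 1) → Fin (n + 2)) :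
    precede s h (Fin.last (t + 1)) = h (Fin.last t) := by
  rw [← Fin.succ_last]; rfl

theorem precede_tail {t : ℕ} (h : Fin (t + 1) → Fin (n + 2)) :
    precede (h 0) (fun i => h i.succ) = h := Fin.cons_self_tail h

theorem log_one_sub_eq (c : Rule n) (t : ℕ) (h : Fin (t + 1) → Fin (n + 2)) (hc : 0 < c t h) :
    Real.log (1 - c t h) = E.W (h (Fin.last t)) (E.wedge c t h) := by
  rw [W, wedge, sub_sub_cancel, logCompl, Real.exp_log hc]

theorem gain_eq (c : Rule n) (t : ℕ) (h : Fin (t + 1) → Fin (n + 2))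
    (hc : ∀ r, 0 < c (t + 1) (extend h r)) :
    E.gain c t h = E.reward (fun r => E.wedge c (t + 1) (extend h r)) - E.wedge c t h := by
  have e : ∀ r, Real.log (1 - c (t + 1) (extend h r)) - Real.log (1 - E.share r) =
      E.W r (E.wedge c (t + 1) (extend h r)) - E.W r 0 := fun r => by
    rw [E.log_one_sub_eq c _ _ (hc r), extend_last, W_zero, ωmin]
  simp only [gain, reward, wedge, logShare] at e ⊢
  rw [Finset.sum_congr rfl fun r _ => by rw [e r]]
  ring

theorem sustainable_iff (s : Fin (n + 2)) (c : Rule n) :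
    E.Sustainable s c ↔ ∀ (t : ℕ) (h : Fin (t + 1) → Fin (n + 2)), h 0 = s →
      0 < c t h ∧ 0 ≤ E.wedge c t h ∧
        E.wedge c t h ≤ E.reward fun r => E.wedge c (t + 1) (extend h r) := by
  constructor
  · intro hs t h h0
    obtain ⟨h1, h2, h3⟩ := hs t h h0
    rw [E.gain_eq c t h fun r => (hs _ _ ((extend_apply_zero h r).trans h0)).1] at h3
    exact ⟨h1, sub_nonneg.2 (Real.log_le_log h1 h2), sub_nonneg.1 h3⟩
  · intro hs t h h0
    obtain ⟨h1, h2, h3⟩ := hs t h h0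
    rw [E.gain_eq c t h fun r => (hs _ _ ((extend_apply_zero h r).trans h0)).1]
    exact ⟨h1, (Real.log_le_log_iff h1 (E.share_pos _)).1 (sub_nonneg.1 h2), sub_nonneg.2 h3⟩

variable {E}

/-- The supremum of all wedges along the rule is at most its own reward, hence at most `maxWedge`.
-/
theorem Sustainable.wedge_mem {s : Fin (n + 2)} {c : Rule n} (hc : E.Sustainable s c) {t : ℕ}
    {h : Fin (t + 1) → Fin (n + 2)} (h0 : h 0 = s) : E.wedge c t h ∈ Icc 0 E.maxWedge := by
  rw [sustainable_iff] at hc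
  refine ⟨(hc t h h0).2.1, ?_⟩
  let S : Set ℝ := {k | ∃ (t : ℕ) (h : Fin (t + 1) → Fin (n + 2)), h 0 = s ∧ k = E.wedge c t h}
  have hS : BddAbove S := by
    refine ⟨E.β * ∑ r, E.prob r * (-E.W r 0), ?_⟩
    rintro k ⟨t, h, h0, rfl⟩
    exact (hc t h h0).2.2.trans
      (E.reward_le fun r => (hc _ _ ((extend_apply_zero h r).trans h0)).2.1)
  have hle : ∀ {t : ℕ} {h : Fin (t + 1) → Fin (n + 2)}, h 0 = s → E.wedge c t h ≤ sSup S :=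
    fun h0 => le_csSup hS ⟨_, _, h0, rfl⟩
  refine (hle h0).trans (E.le_maxWedge ((hc t h h0).2.1.trans (hle h0)) ?_)
  refine csSup_le ⟨_, t, h, h0, rfl⟩ ?_
  rintro k ⟨t, h, h0, rfl⟩
  exact (hc t h h0).2.2.trans (E.reward_mono
    (fun r => (hc _ _ ((extend_apply_zero h r).trans h0)).2.1)
    fun r => hle ((extend_apply_zero h r).trans h0))

variable (E)

/-! ### Payoffs, continuations and gluing of rules -/

/-- The planner's payoff in a period in state `s` with wedge `k`. -/
noncomputable def flow (s : Fin (n + 2)) (k : ℝ) : ℝ :=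
  E.β / E.δ * E.W s k + (E.logShare s - k)

theorem flow_nonpos (s : Fin (n + 2)) {k : ℝ} (hk : 0 ≤ k) : E.flow s k ≤ 0 := by
  have h1 := mul_nonpos_of_nonneg_of_nonpos (div_pos E.β_pos E.δ_pos).le (E.W_neg s hk).le
  have h2 := E.logShare_sub_neg s hk
  rw [flow]; linarith

theorem flow_ge (s : Fin (n + 2)) {k : ℝ} (hk : k ∈ Icc 0 E.maxWedge) :
    E.β / E.δ * E.W s 0 + (E.logShare s - E.maxWedge) ≤ E.flow s k := by
  have h1 := mul_le_mul_of_nonneg_left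
    (E.W_monotoneOn s (self_mem_Ici : (0 : ℝ) ∈ Ici 0) (hk.1 : k ∈ Ici 0) hk.1)
    (div_pos E.β_pos E.δ_pos).le
  rw [flow]; linarith [hk.2]

theorem exists_flow_ge : ∃ B, ∀ (s : Fin (n + 2)) (k : ℝ), k ∈ Icc 0 E.maxWedge →
    |E.flow s k| ≤ B := by
  obtain ⟨B, hB⟩ := Finite.exists_le fun s : Fin (n + 2) =>
    -(E.β / E.δ * E.W s 0 + (E.logShare s - E.maxWedge))
  refine ⟨B, fun s k hk => abs_le.2 ⟨?_, ?_⟩⟩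
  · linarith [hB s, E.flow_ge s hk]
  · have h1 := E.flow_nonpos s hk.1
    linarith [hB s, E.flow_ge s hk]

theorem flow_strictConcaveOn (s : Fin (n + 2)) : StrictConcaveOn ℝ (Ici 0) (E.flow s) := by
  refine ⟨convex_Ici 0, fun x hx y hy hxy a b ha hb hab => ?_⟩
  have h := mul_lt_mul_of_pos_left ((E.W_strictConcaveOn s).2 hx hy hxy ha hb hab)
    (div_pos E.β_pos E.δ_pos)
  simp only [smul_eq_mul, flow] at h ⊢
  have e : E.logShare s = a * E.logShare s + b * E.logShare s := by rw [← add_mul, hab, one_mul]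
  linarith

theorem continuousOn_flow (s : Fin (n + 2)) : ContinuousOn (E.flow s) (Ici 0) :=
  (continuousOn_const.mul (E.continuousOn_W s)).add (by fun_prop)

theorem periodPayoff_eq (c : Rule n) (t : ℕ) (h : Fin (t + 1) → Fin (n + 2)) (hc : 0 < c t h) :
    E.periodPayoff (c t h) = E.flow (h (Fin.last t)) (E.wedge c t h) := by
  rw [periodPayoff, E.log_one_sub_eq c t h hc, flow]
  simp [wedge]

/-- The expected payoff at date `t`. -/
noncomputable def expected (s : Fin (n + 2)) (c : Rule n) (t : ℕ) : ℝ :=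
  ∑ h : Fin t → Fin (n + 2), (∏ k, E.prob (h k)) * E.periodPayoff (c t (precede s h))

theorem payoff_eq (s : Fin (n + 2)) (c : Rule n) :
    E.payoff s c = ∑' t, E.δ ^ t * E.expected s c t := rfl

theorem sum_prod_prob (t : ℕ) : ∑ h : Fin t → Fin (n + 2), ∏ k, E.prob (h k) = 1 := by
  have := Fintype.prod_sum (fun (_ : Fin t) (j : Fin (n + 2)) => E.prob j)
  rw [← this]
  simp [E.prob_sum]

theorem expected_nonpos {s : Fin (n + 2)} {c : Rule n} (hc : E.Sustainable s c) (t : ℕ) :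
    E.expected s c t ≤ 0 := by
  refine Finset.sum_nonpos fun h _ => mul_nonpos_of_nonneg_of_nonpos
    (Finset.prod_nonneg fun k _ => (E.prob_pos _).le) ?_
  rw [E.periodPayoff_eq c t _ (hc t _ rfl).1]
  exact E.flow_nonpos _ (hc.wedge_mem rfl).1

theorem summable_expected {s : Fin (n + 2)} {c : Rule n} (hc : E.Sustainable s c) :
    Summable fun t => E.δ ^ t * E.expected s c t := by
  obtain ⟨B, hB⟩ := E.exists_flow_ge
  refine Summable.of_norm_bounded (g := fun t => E.δ ^ t * B)
    ((summable_geometric_of_lt_one E.δ_pos.le E.δ_lt_one).mul_right B) fun t => ?_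
  rw [Real.norm_eq_abs, abs_mul, abs_of_nonneg (pow_nonneg E.δ_pos.le t)]
  refine mul_le_mul_of_nonneg_left ?_ (pow_nonneg E.δ_pos.le t)
  calc |E.expected s c t|
      ≤ ∑ h : Fin t → Fin (n + 2),
          |(∏ k, E.prob (h k)) * E.periodPayoff (c t (precede s h))| :=
        Finset.abs_sum_le_sum_abs _ _
    _ ≤ ∑ h : Fin t → Fin (n + 2), (∏ k, E.prob (h k)) * B := by
        refine Finset.sum_le_sum fun h _ => ?_
        have hp : 0 ≤ ∏ k, E.prob (h k) := Finset.prod_nonneg fun k _ => (E.prob_pos _).le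
        rw [abs_mul, abs_of_nonneg hp, E.periodPayoff_eq c t _ (hc t _ rfl).1]
        exact mul_le_mul_of_nonneg_left (hB _ _ (hc.wedge_mem rfl)) hp
    _ = B := by rw [← Finset.sum_mul, sum_prod_prob, one_mul]

theorem payoff_nonpos {s : Fin (n + 2)} {c : Rule n} (hc : E.Sustainable s c) :
    E.payoff s c ≤ 0 :=
  tsum_nonpos fun t => mul_nonpos_of_nonneg_of_nonpos (pow_nonneg E.δ_pos.le t)
    (E.expected_nonpos hc t)

/-- The continuation of the rule `c` from the second date on when the initial state is `s`. -/
def continuation (c : Rule n) (s : Fin (n + 2)) : Rule n := fun t h => c (t + 1) (precede s h)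

theorem wedge_continuation (c : Rule n) (s : Fin (n + 2)) (t : ℕ)
    (h : Fin (t + 1) → Fin (n + 2)) :
    E.wedge (continuation c s) t h = E.wedge c (t + 1) (precede s h) := by
  rw [wedge, wedge, precede_last, continuation]

theorem Sustainable.continuation {s : Fin (n + 2)} {c : Rule n} (hc : E.Sustainable s c)
    (r : Fin (n + 2)) : E.Sustainable r (continuation c s) := by
  rw [sustainable_iff] at hc ⊢
  intro t h _
  obtain ⟨h1, h2, h3⟩ := hc (t + 1) (precede s h) rfl
  simp only [wedge_continuation, ← extend_precede]
  exact ⟨h1, h2, h3⟩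

theorem expected_succ (s : Fin (n + 2)) (c : Rule n) (t : ℕ) :
    E.expected s c (t + 1) = ∑ r, E.prob r * E.expected r (continuation c s) t := by
  rw [expected, ← (Fin.consEquiv fun _ => Fin (n + 2)).sum_comp, Fintype.sum_prod_type]
  refine Finset.sum_congr rfl fun r _ => ?_
  rw [expected, Finset.mul_sum]
  refine Finset.sum_congr rfl fun h _ => ?_
  rw [Fin.prod_univ_succ]
  simp only [Fin.consEquiv_apply, Fin.cons_zero, Fin.cons_succ, continuation]
  rw [← mul_assoc]
  rfl

theorem expected_zero (s : Fin (n + 2)) (c : Rule n) :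
    E.expected s c 0 = E.periodPayoff (c 0 fun _ => s) := by
  rw [expected, Fintype.sum_unique]
  have : ∀ h : Fin 0 → Fin (n + 2), precede s h = fun _ => s := fun h => by
    funext i; rw [Fin.fin_one_eq_zero i]; rfl
  simp [this]

/-- Split off date 0 and condition on the state at date 1; summability permits exchanging the series
with the finite sum over states. -/
theorem payoff_recursion {s : Fin (n + 2)} {c : Rule n} (hc : E.Sustainable s c) :
    E.payoff s c = E.flow s (E.wedge c 0 fun _ => s) +
      E.δ * ∑ r, E.prob r * E.payoff r (continuation c s) := by
  rw [payoff_eq, (E.summable_expected hc).tsum_eq_zero_add, expected_zero, pow_zero, one_mul,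
    E.periodPayoff_eq c 0 _ (hc 0 _ rfl).1]
  congr 1
  have e : ∀ t, E.δ ^ (t + 1) * E.expected s c (t + 1) =
      ∑ r, E.δ * (E.prob r * (E.δ ^ t * E.expected r (continuation c s) t)) := fun t => by
    rw [expected_succ, Finset.mul_sum]
    exact Finset.sum_congr rfl fun r _ => by ring
  simp only [e]
  rw [Summable.tsum_finsetSum fun r _ =>
    (((E.summable_expected (hc.continuation E r)).mul_left _).mul_left _), Finset.mul_sum]
  refine Finset.sum_congr rfl fun r _ => ?_
  rw [tsum_mul_left, tsum_mul_left, payoff_eq]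

/-- The rule with wedge `k` in the initial state `s` that continues with the rule `c r` when the
next state is `r`. -/
noncomputable def glue (s : Fin (n + 2)) (k : ℝ) (c : Fin (n + 2) → Rule n) : Rule n
  | 0, _ => Real.exp (E.logShare s - k)
  | t + 1, h => c (h 1) t fun i => h i.succ

theorem wedge_glue_zero (s : Fin (n + 2)) (k : ℝ) (c : Fin (n + 2) → Rule n)
    {h : Fin 1 → Fin (n + 2)} (h0 : h 0 = s) : E.wedge (E.glue s k c) 0 h = k := by
  rw [wedge, glue, Real.log_exp]
  have : h (Fin.last 0) = s := h0
  rw [this]; ring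

theorem wedge_glue_succ (s : Fin (n + 2)) (k : ℝ) (c : Fin (n + 2) → Rule n) (t : ℕ)
    (h : Fin (t + 2) → Fin (n + 2)) :
    E.wedge (E.glue s k c) (t + 1) h = E.wedge (c (h 1)) t fun i => h i.succ := rfl

theorem extend_one {t : ℕ} (h : Fin (t + 2) → Fin (n + 2)) (r : Fin (n + 2)) :
    extend h r 1 = h 1 := by
  have : (1 : Fin (t + 3)) = Fin.castSucc (1 : Fin (t + 2)) := rfl
  rw [this]
  exact Fin.snoc_castSucc (α := fun _ => Fin (n + 2)) r h 1

theorem extend_succ {t : ℕ} (h : Fin (t + 1) → Fin (n + 2)) (r : Fin (n + 2)) :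
    (fun i : Fin (t + 1) => extend h r i.succ) = extend (fun i => h i.succ) r := by
  conv_lhs => rw [← precede_tail h, extend_precede]
  rfl

theorem sustainable_glue (s : Fin (n + 2)) {k : ℝ} (c : Fin (n + 2) → Rule n)
    (hc : ∀ r, E.Sustainable r (c r)) (hk : 0 ≤ k)
    (hle : k ≤ E.reward fun r => E.wedge (c r) 0 fun _ => r) :
    E.Sustainable s (E.glue s k c) := by
  rw [sustainable_iff]
  intro t h h0
  rcases t with - | t
  · simp only [wedge_glue_zero E s k c h0, wedge_glue_succ]
    refine ⟨Real.exp_pos _, hk, hle.trans_eq (congrArg _ (funext fun r => ?_))⟩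
    have e1 : extend h r 1 = r := extend_last h r
    have e2 : (fun i : Fin 1 => extend h r i.succ) = fun _ => r := by
      funext i; rw [Subsingleton.elim i 0]; exact e1
    rw [e2, e1]
  · simp only [wedge_glue_succ, extend_one, extend_succ]
    exact (E.sustainable_iff _ _).1 (hc (h 1)) t (fun i => h i.succ) rfl

theorem payoff_glue (s : Fin (n + 2)) {k : ℝ} (c : Fin (n + 2) → Rule n)
    (hg : E.Sustainable s (E.glue s k c)) :
    E.payoff s (E.glue s k c) = E.flow s k + E.δ * ∑ r, E.prob r * E.payoff r (c r) := by
  rw [E.payoff_recursion hg, wedge_glue_zero E s k c rfl]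
  rfl

/-- The rule with the constant wedge `k`. -/
noncomputable def constRule (k : ℝ) : Rule n := fun t h =>
  Real.exp (E.logShare (h (Fin.last t)) - k)

theorem wedge_constRule (k : ℝ) (t : ℕ) (h : Fin (t + 1) → Fin (n + 2)) :
    E.wedge (E.constRule k) t h = k := by
  rw [wedge, constRule, Real.log_exp]; ring

theorem sustainable_constRule (s : Fin (n + 2)) : E.Sustainable s (E.constRule E.maxWedge) := by
  rw [sustainable_iff]
  intro t h _
  simp only [wedge_constRule]
  exact ⟨Real.exp_pos _, E.maxWedge_nonneg, E.reward_maxWedge.ge⟩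

/-! ### Bellman's equation and concavity -/

/-- The set of payoffs of the sustainable rules with initial wedge `k`. -/
def payoffs (s : Fin (n + 2)) (k : ℝ) : Set ℝ :=
  {v | ∃ c, E.Sustainable s c ∧ (E.wedge c 0 fun _ => s) = k ∧ v = E.payoff s c}

/-- The optimal payoff over the sustainable rules with initial wedge `k`. -/
noncomputable def H (s : Fin (n + 2)) (k : ℝ) : ℝ := sSup (E.payoffs s k)

theorem bddAbove_payoffs (s : Fin (n + 2)) (k : ℝ) : BddAbove (E.payoffs s k) :=
  ⟨0, by rintro v ⟨c, hc, -, rfl⟩; exact E.payoff_nonpos hc⟩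

theorem payoffs_nonempty (s : Fin (n + 2)) {k : ℝ} (hk : k ∈ Icc 0 E.maxWedge) :
    (E.payoffs s k).Nonempty := by
  have hg := E.sustainable_glue s (k := k) (fun _ => E.constRule E.maxWedge)
    (fun r => E.sustainable_constRule r) hk.1
    (by simp only [wedge_constRule]; exact hk.2.trans_eq E.reward_maxWedge.symm)
  exact ⟨_, _, hg, E.wedge_glue_zero s k _ rfl, rfl⟩

theorem payoff_le_H {s : Fin (n + 2)} {c : Rule n} (hc : E.Sustainable s c) :
    E.payoff s c ≤ E.H s (E.wedge c 0 fun _ => s) :=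
  le_csSup (E.bddAbove_payoffs s _) ⟨c, hc, rfl, rfl⟩

theorem exists_payoff_gt (s : Fin (n + 2)) {k : ℝ} (hk : k ∈ Icc 0 E.maxWedge) {v : ℝ}
    (hv : v < E.H s k) :
    ∃ c, E.Sustainable s c ∧ (E.wedge c 0 fun _ => s) = k ∧ v < E.payoff s c := by
  obtain ⟨_, ⟨c, hc, hk, rfl⟩, hlt⟩ := exists_lt_of_lt_csSup (E.payoffs_nonempty s hk) hv
  exact ⟨c, hc, hk, hlt⟩

theorem H_nonpos (s : Fin (n + 2)) {k : ℝ} (hk : k ∈ Icc 0 E.maxWedge) : E.H s k ≤ 0 :=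
  csSup_le (E.payoffs_nonempty s hk) (by rintro v ⟨c, hc, -, rfl⟩; exact E.payoff_nonpos hc)

/-- The expected continuation payoffs that are compatible with the wedge `k`. -/
def continuations (k : ℝ) : Set ℝ :=
  {v | ∃ κ : Fin (n + 2) → ℝ, (∀ r, κ r ∈ Icc 0 E.maxWedge) ∧ k ≤ E.reward κ ∧
    v = ∑ r, E.prob r * E.H r (κ r)}

/-- The optimal expected continuation payoff when the young give up the wedge `k`. -/
noncomputable def G (k : ℝ) : ℝ := sSup (E.continuations k)

theorem bddAbove_continuations (k : ℝ) : BddAbove (E.continuations k) :=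
  ⟨0, by
    rintro v ⟨κ, hκ, -, rfl⟩
    exact Finset.sum_nonpos fun r _ => mul_nonpos_of_nonneg_of_nonpos (E.prob_pos r).le
      (E.H_nonpos r (hκ r))⟩

theorem maxWedge_mem : E.maxWedge ∈ Icc 0 E.maxWedge := ⟨E.maxWedge_nonneg, le_rfl⟩

theorem continuations_nonempty {k : ℝ} (hk : k ≤ E.maxWedge) : (E.continuations k).Nonempty :=
  ⟨_, fun _ => E.maxWedge, fun _ => E.maxWedge_mem, hk.trans_eq E.reward_maxWedge.symm, rfl⟩

theorem le_G {k : ℝ} {κ : Fin (n + 2) → ℝ} (hκ : ∀ r, κ r ∈ Icc 0 E.maxWedge)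
    (hk : k ≤ E.reward κ) : ∑ r, E.prob r * E.H r (κ r) ≤ E.G k :=
  le_csSup (E.bddAbove_continuations k) ⟨κ, hκ, hk, rfl⟩

/-- Bellman's equation. -/
theorem H_eq (s : Fin (n + 2)) {k : ℝ} (hk : k ∈ Icc 0 E.maxWedge) :
    E.H s k = E.flow s k + E.δ * E.G k := by
  apply le_antisymm
  · refine csSup_le (E.payoffs_nonempty s hk) ?_
    rintro v ⟨c, hc, rfl, rfl⟩
    rw [E.payoff_recursion hc]
    have hw : ∀ r, E.wedge (continuation c s) 0 (fun _ => r) =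
        E.wedge c 1 (extend (fun _ => s) r) :=
      fun r => by
        rw [wedge_continuation]
        congr 1
        funext i
        fin_cases i <;> rfl
    refine add_le_add_right (mul_le_mul_of_nonneg_left (le_trans (Finset.sum_le_sum fun r _ =>
      mul_le_mul_of_nonneg_left (E.payoff_le_H (hc.continuation E r)) (E.prob_pos r).le)
      (E.le_G (fun r => (hc.continuation E r).wedge_mem rfl) ?_)) E.δ_pos.le) _
    simp only [hw]
    exact ((E.sustainable_iff s c).1 hc 0 (fun _ => s) rfl).2.2
  · have key : E.G k ≤ (E.H s k - E.flow s k) / E.δ := by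
      refine csSup_le (E.continuations_nonempty hk.2) ?_
      rintro v ⟨κ, hκ, hle, rfl⟩
      rw [le_div_iff₀ E.δ_pos]
      -- Optimal rules are not yet known to exist, so rules within ε of the optimum are glued.
      refine le_of_forall_pos_le_add fun ε hε => ?_
      choose c hc hck hlt using fun r => E.exists_payoff_gt r (hκ r)
        (sub_lt_self (E.H r (κ r)) hε)
      have hg := E.sustainable_glue s c hc hk.1 (by simpa only [hck] using hle)
      have h1 := E.payoff_le_H hg
      rw [E.payoff_glue s c hg, E.wedge_glue_zero s k c rfl] at h1
      have h2 : ∑ r, E.prob r * E.H r (κ r) ≤ ∑ r, E.prob r * E.payoff r (c r) + ε := by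
        have : ∑ r, E.prob r * E.H r (κ r) ≤ ∑ r, E.prob r * (E.payoff r (c r) + ε) :=
          Finset.sum_le_sum fun r _ =>
            mul_le_mul_of_nonneg_left (by linarith [hlt r]) (E.prob_pos r).le
        simpa only [mul_add, Finset.sum_add_distrib, ← Finset.sum_mul, E.prob_sum, one_mul]
          using this
      nlinarith [E.δ_pos, E.δ_lt_one]
    rw [le_div_iff₀ E.δ_pos] at key
    linarith

theorem G_antitoneOn : AntitoneOn E.G (Icc 0 E.maxWedge) := by
  intro k _ k' hk' hkk
  refine csSup_le (E.continuations_nonempty hk'.2) ?_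
  rintro v ⟨κ, hκ, hle, rfl⟩
  exact E.le_G hκ (hkk.trans hle)

/-- The rule whose wedges are the convex combination of those of two rules. -/
noncomputable def mix (a b : ℝ) (c c' : Rule n) : Rule n := fun t h =>
  Real.exp (a * Real.log (c t h) + b * Real.log (c' t h))

theorem wedge_mix {a b : ℝ} (hab : a + b = 1) (c c' : Rule n) (t : ℕ)
    (h : Fin (t + 1) → Fin (n + 2)) :
    E.wedge (mix a b c c') t h = a * E.wedge c t h + b * E.wedge c' t h := by
  rw [wedge, mix, Real.log_exp, wedge, wedge]
  linear_combination (-E.logShare (h (Fin.last t))) * hab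

theorem sustainable_mix {s : Fin (n + 2)} {a b : ℝ} (ha : 0 ≤ a) (hb : 0 ≤ b) (hab : a + b = 1)
    {c c' : Rule n} (hc : E.Sustainable s c) (hc' : E.Sustainable s c') :
    E.Sustainable s (mix a b c c') := by
  rw [sustainable_iff] at hc hc' ⊢
  intro t h h0
  obtain ⟨-, h2, h3⟩ := hc t h h0
  obtain ⟨-, h2', h3'⟩ := hc' t h h0
  simp only [E.wedge_mix hab]
  refine ⟨Real.exp_pos _, by positivity, le_trans ?_ (E.reward_concave
    (fun r => (hc _ _ ((extend_apply_zero h r).trans h0)).2.1)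
    (fun r => (hc' _ _ ((extend_apply_zero h r).trans h0)).2.1) ha hb hab)⟩
  gcongr

/-- Mixing geometrically in consumption is mixing linearly in wedges, and `flow` is concave in the
wedge after every history. -/
theorem payoff_mix {s : Fin (n + 2)} {a b : ℝ} (ha : 0 ≤ a) (hb : 0 ≤ b) (hab : a + b = 1)
    {c c' : Rule n} (hc : E.Sustainable s c) (hc' : E.Sustainable s c') :
    a * E.payoff s c + b * E.payoff s c' ≤ E.payoff s (mix a b c c') := by
  have hm := E.sustainable_mix ha hb hab hc hc'
  rw [payoff_eq, payoff_eq, payoff_eq, ← tsum_mul_left, ← tsum_mul_left,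
    ← ((E.summable_expected hc).mul_left a).tsum_add ((E.summable_expected hc').mul_left b)]
  refine Summable.tsum_le_tsum (fun t => ?_) (((E.summable_expected hc).mul_left a).add
    ((E.summable_expected hc').mul_left b)) (E.summable_expected hm)
  have e : a * E.expected s c t + b * E.expected s c' t ≤ E.expected s (mix a b c c') t := by
    rw [expected, expected, expected, Finset.mul_sum, Finset.mul_sum, ← Finset.sum_add_distrib]
    refine Finset.sum_le_sum fun h _ => ?_
    have hp : 0 ≤ ∏ k, E.prob (h k) := Finset.prod_nonneg fun k _ => (E.prob_pos _).le
    rw [E.periodPayoff_eq c t _ (hc t _ rfl).1, E.periodPayoff_eq c' t _ (hc' t _ rfl).1,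
      E.periodPayoff_eq _ t _ (hm t _ rfl).1, E.wedge_mix hab]
    have := (E.flow_strictConcaveOn (precede s h (Fin.last t))).concaveOn.2
      (hc.wedge_mem (h := precede s h) rfl).1 (hc'.wedge_mem (h := precede s h) rfl).1 ha hb hab
    simp only [smul_eq_mul] at this
    nlinarith
  have := mul_le_mul_of_nonneg_left e (pow_nonneg E.δ_pos.le t)
  linarith

theorem H_concaveOn (s : Fin (n + 2)) : ConcaveOn ℝ (Icc 0 E.maxWedge) (E.H s) := by
  refine ⟨convex_Icc _ _, fun x hx y hy a b ha hb hab => ?_⟩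
  refine le_of_forall_pos_le_add fun ε hε => ?_
  obtain ⟨c, hc, hcx, hlt⟩ := E.exists_payoff_gt s hx (sub_lt_self (E.H s x) hε)
  obtain ⟨c', hc', hcy, hlt'⟩ := E.exists_payoff_gt s hy (sub_lt_self (E.H s y) hε)
  have h1 := E.payoff_le_H (E.sustainable_mix ha hb hab hc hc')
  rw [E.wedge_mix hab, hcx, hcy] at h1
  have h2 := E.payoff_mix ha hb hab hc hc'
  simp only [smul_eq_mul]
  have h3 : ε = a * ε + b * ε := by rw [← add_mul, hab, one_mul]
  have h4 := mul_le_mul_of_nonneg_left hlt.le ha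
  have h5 := mul_le_mul_of_nonneg_left hlt'.le hb
  linarith

theorem G_concaveOn : ConcaveOn ℝ (Icc 0 E.maxWedge) E.G := by
  refine ⟨convex_Icc _ _, fun x hx y hy a b ha hb hab => ?_⟩
  refine le_of_forall_pos_le_add fun ε hε => ?_
  obtain ⟨_, ⟨κ, hκ, hle, rfl⟩, hlt⟩ :=
    exists_lt_of_lt_csSup (E.continuations_nonempty hx.2) (sub_lt_self (E.G x) hε)
  obtain ⟨_, ⟨κ', hκ', hle', rfl⟩, hlt'⟩ :=
    exists_lt_of_lt_csSup (E.continuations_nonempty hy.2) (sub_lt_self (E.G y) hε)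
  have hmem : ∀ r, a * κ r + b * κ' r ∈ Icc 0 E.maxWedge := fun r =>
    convex_Icc 0 E.maxWedge (hκ r) (hκ' r) ha hb hab
  have h1 : ∑ r, E.prob r * E.H r (a * κ r + b * κ' r) ≤ E.G (a • x + b • y) := by
    refine E.le_G hmem (le_trans ?_ (E.reward_concave (fun r => (hκ r).1) (fun r => (hκ' r).1)
      ha hb hab))
    simp only [smul_eq_mul]
    gcongr
  have h2 : a * ∑ r, E.prob r * E.H r (κ r) + b * ∑ r, E.prob r * E.H r (κ' r) ≤
      ∑ r, E.prob r * E.H r (a * κ r + b * κ' r) := by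
    rw [Finset.mul_sum, Finset.mul_sum, ← Finset.sum_add_distrib]
    refine Finset.sum_le_sum fun r _ => ?_
    have := mul_le_mul_of_nonneg_left ((E.H_concaveOn r).2 (hκ r) (hκ' r) ha hb hab)
      (E.prob_pos r).le
    simp only [smul_eq_mul] at this
    linarith
  simp only [smul_eq_mul] at h1 ⊢
  have h3 : ε = a * ε + b * ε := by rw [← add_mul, hab, one_mul]
  have h4 := mul_le_mul_of_nonneg_left hlt.le ha
  have h5 := mul_le_mul_of_nonneg_left hlt'.le hb
  linarith

end Economy

/-! ### A first-order condition without differentiability of the concave part -/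

/-- If `A + B` is maximal at `x`, `A` is differentiable and `B` concave, then `B` plus the
linearization of `A` is maximal at `x`. -/
theorem ConcaveOn.add_deriv_mul_le {S : Set ℝ} {A B : ℝ → ℝ} {A' x y : ℝ}
    (hB : ConcaveOn ℝ S B) (hA : HasDerivAt A A' x) (hx : x ∈ S) (hy : y ∈ S)
    (hmax : ∀ z ∈ S, A z + B z ≤ A x + B x) : B y + A' * y ≤ B x + A' * x := by
  have hd : HasDerivAt (fun t : ℝ => A (x + t * (y - x))) (A' * (y - x)) 0 := by
    have h1 : HasDerivAt (fun t : ℝ => x + t * (y - x)) (y - x) 0 := by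
      simpa using ((hasDerivAt_id (0 : ℝ)).mul_const (y - x)).const_add x
    have h2 : HasDerivAt A A' (x + 0 * (y - x)) := by simpa using hA
    exact h2.comp 0 h1
  have ht := (hasDerivAt_iff_tendsto_slope.1 hd).mono_left
    (nhdsWithin_mono _ fun t (ht : (0 : ℝ) < t) => ne_of_gt ht : 𝓝[>] (0 : ℝ) ≤ _)
  have hev : ∀ᶠ t in 𝓝[>] (0 : ℝ),
      slope (fun t : ℝ => A (x + t * (y - x))) 0 t ≤ B x - B y := by
    filter_upwards [Ioo_mem_nhdsGT (zero_lt_one' ℝ)] with t ht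
    have hc := hB.2 hx hy (sub_nonneg.2 ht.2.le) ht.1.le (by ring)
    have hm := hB.1 hx hy (sub_nonneg.2 ht.2.le) ht.1.le (by ring)
    have e : (1 - t) • x + t • y = x + t * (y - x) := by simp only [smul_eq_mul]; ring
    rw [e] at hc hm
    have h := hmax _ hm
    simp only [smul_eq_mul] at hc
    rw [slope_def_field, div_le_iff₀ (by linarith [ht.1])]
    simp only [zero_mul, add_zero, sub_zero]
    nlinarith
  have := le_of_tendsto ht hev
  linarith

/-! ### Continuity of the continuation value and existence of optimal wedges -/

namespace Economy

variable {n : ℕ} (E : Economy n)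

/-- Near 0, `G` lies between its chord, by concavity, and its value at 0, by monotonicity. -/
theorem continuousWithinAt_G_zero (hK : 0 < E.maxWedge) :
    ContinuousWithinAt E.G (Icc 0 E.maxWedge) 0 := by
  have h0 : (0 : ℝ) ∈ Icc 0 E.maxWedge := ⟨le_rfl, hK.le⟩
  have hlim : Tendsto (fun k => (1 - k / E.maxWedge) * E.G 0 + k / E.maxWedge * E.G E.maxWedge)
      (𝓝[Icc 0 E.maxWedge] 0) (𝓝 (E.G 0)) := by
    have : Continuous fun k : ℝ =>
        (1 - k / E.maxWedge) * E.G 0 + k / E.maxWedge * E.G E.maxWedge := by fun_prop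
    simpa using (this.tendsto 0).mono_left nhdsWithin_le_nhds
  refine tendsto_of_tendsto_of_tendsto_of_le_of_le' hlim tendsto_const_nhds ?_ ?_
  · filter_upwards [self_mem_nhdsWithin] with k hk
    have h1 : k / E.maxWedge ≤ 1 := (div_le_one hK).2 hk.2
    have := E.G_concaveOn.2 h0 E.maxWedge_mem (sub_nonneg.2 h1) (div_nonneg hk.1 hK.le)
      (by ring)
    simp only [smul_eq_mul, mul_zero, zero_add, div_mul_cancel₀ _ hK.ne'] at this
    exact this
  · filter_upwards [self_mem_nhdsWithin] with k hk
    exact E.G_antitoneOn h0 hk hk.1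

theorem reward_update_lt (hK : 0 < E.maxWedge) {k : ℝ} (hk : k ∈ Ico 0 E.maxWedge)
    (r : Fin (n + 2)) :
    E.reward (Function.update (fun _ => E.maxWedge) r k) < E.maxWedge := by
  have h0 : ∀ i, 0 ≤ Function.update (fun _ => E.maxWedge) r k i := fun i => by
    rcases eq_or_ne i r with rfl | hi
    · simpa using hk.1
    · simpa [hi] using hK.le
  have hle : ∀ i, Function.update (fun _ => E.maxWedge) r k i ≤ E.maxWedge := fun i => by
    rcases eq_or_ne i r with rfl | hi
    · simpa using hk.2.le
    · simp [hi]
  by_contra hcon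
  have := E.eq_of_reward_le h0 hle (E.reward_maxWedge.trans_le (not_lt.1 hcon)) r
  rw [Function.update_self] at this
  exact hk.2.ne this

/-- Wedges that sustain a wedge close to the maximal one are close to it themselves. -/
theorem exists_lt_maxWedge (hK : 0 < E.maxWedge) {k : ℝ} (hk : k ∈ Ico 0 E.maxWedge) :
    ∃ k' ∈ Ico 0 E.maxWedge, ∀ κ : Fin (n + 2) → ℝ, (∀ r, κ r ∈ Icc 0 E.maxWedge) →
      k' ≤ E.reward κ → ∀ r, k ≤ κ r := by
  obtain ⟨r0, hr0⟩ := Finite.exists_max fun r =>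
    E.reward (Function.update (fun _ => E.maxWedge) r k)
  obtain ⟨k', hk1, hk2⟩ := exists_between (max_lt hK (E.reward_update_lt hK hk r0))
  refine ⟨k', ⟨((le_max_left _ _).trans_lt hk1).le, hk2⟩, fun κ hκ hle r => ?_⟩
  by_contra hlt
  have : E.reward κ ≤ E.reward (Function.update (fun _ => E.maxWedge) r k) := by
    refine E.reward_mono (fun r => (hκ r).1) fun i => ?_
    rcases eq_or_ne i r with rfl | hi
    · simpa using (not_le.1 hlt).le
    · simpa [hi] using (hκ i).2
  exact absurd (hle.trans (this.trans (hr0 r))) (not_le.2 ((le_max_right _ _).trans_lt hk1))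

/-- Concavity alone allows a downward jump at K. It is excluded by the recursion: a wedge near K
needs all subsequent wedges near K, so the left limit satisfies l ≤ C + δ l, while constant wedges K
give G K ≥ C + δ G K. Since δ < 1, l ≤ G K. -/
theorem continuousWithinAt_G_maxWedge (hK : 0 < E.maxWedge) :
    ContinuousWithinAt E.G (Icc 0 E.maxWedge) E.maxWedge := by
  set K := E.maxWedge with hKdef
  have hbdd : BddBelow (E.G '' Ico 0 K) := ⟨E.G K, by
    rintro _ ⟨k, hk, rfl⟩
    exact E.G_antitoneOn ⟨hk.1, hk.2.le⟩ E.maxWedge_mem hk.2.le⟩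
  have hne : (E.G '' Ico 0 K).Nonempty := ⟨_, 0, ⟨le_rfl, hK⟩, rfl⟩
  set l := sInf (E.G '' Ico 0 K) with hl
  have hKl : E.G K ≤ l := le_csInf hne (by
    rintro _ ⟨k, hk, rfl⟩
    exact E.G_antitoneOn ⟨hk.1, hk.2.le⟩ E.maxWedge_mem hk.2.le)
  set C := ∑ r, E.prob r * E.flow r K with hC
  have hlow : C + E.δ * E.G K ≤ E.G K := by
    have := E.le_G (k := K) (fun _ => E.maxWedge_mem) E.reward_maxWedge.ge
    refine le_trans (le_of_eq ?_) this
    simp only [E.H_eq _ E.maxWedge_mem, mul_add, Finset.sum_add_distrib, ← Finset.sum_mul,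
      E.prob_sum, one_mul]
    rfl
  have hup : ∀ ε > 0, l ≤ C + ε + E.δ * (l + ε) := by
    intro ε hε
    obtain ⟨_, ⟨k1, hk1, rfl⟩, hlt⟩ := exists_lt_of_csInf_lt hne (lt_add_of_pos_right l hε)
    have hfl : ∀ᶠ k in 𝓝[<] K, k ∈ Ico k1 K ∧ ∀ r, ∀ x ∈ Icc k K, E.flow r x ≤ E.flow r K + ε := by
      have hI : ∀ᶠ k in 𝓝[<] K, k ∈ Ico k1 K := Ico_mem_nhdsLT hk1.2
      refine hI.and ?_
      rw [eventually_all]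
      intro r
      have hc := (E.continuousOn_flow r K hK.le).eventually
        (gt_mem_nhds (lt_add_of_pos_right (E.flow r K) hε))
      rw [eventually_nhdsWithin_iff, Metric.eventually_nhds_iff] at hc
      obtain ⟨d, hd, hball⟩ := hc
      filter_upwards [Ico_mem_nhdsLT (show max 0 (K - d / 2) < K from max_lt hK (by linarith))]
        with k hk x hx
      have h1 := (le_max_left _ _).trans hk.1
      have h2 := (le_max_right _ _).trans hk.1
      refine (hball ?_ (h1.trans hx.1 : x ∈ Ici 0)).le
      rw [Real.dist_eq, abs_lt]
      constructor <;> linarith [hx.1, hx.2]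
    obtain ⟨k2, hk2, hfl⟩ := hfl.exists
    obtain ⟨k3, hk3, hκ3⟩ := E.exists_lt_maxWedge hK (k := k2) ⟨hk1.1.trans hk2.1, hk2.2⟩
    have h1 : l ≤ E.G k3 := csInf_le hbdd ⟨k3, hk3, rfl⟩
    refine h1.trans (csSup_le (E.continuations_nonempty hk3.2.le) ?_)
    rintro v ⟨κ, hκ, hle, rfl⟩
    have hr : ∀ r, E.H r (κ r) ≤ E.flow r K + ε + E.δ * (l + ε) := fun r => by
      have hκr := hκ3 κ hκ hle r
      rw [E.H_eq r (hκ r)]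
      have h2 := hfl r (κ r) ⟨hκr, (hκ r).2⟩
      have h3 := E.G_antitoneOn ⟨hk1.1, hk1.2.le⟩ (hκ r) (hk2.1.trans hκr)
      have h4 := mul_le_mul_of_nonneg_left (h3.trans hlt.le) E.δ_pos.le
      linarith
    calc ∑ r, E.prob r * E.H r (κ r)
        ≤ ∑ r, E.prob r * (E.flow r K + ε + E.δ * (l + ε)) :=
          Finset.sum_le_sum fun r _ => mul_le_mul_of_nonneg_left (hr r) (E.prob_pos r).le
      _ = C + ε + E.δ * (l + ε) := by
          simp only [mul_add, Finset.sum_add_distrib, ← Finset.sum_mul, E.prob_sum, one_mul]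
          rfl
  have hlC : l ≤ C + E.δ * l := le_of_forall_pos_le_add fun ε hε => by
    have := hup (ε / 2) (by positivity)
    nlinarith [E.δ_lt_one]
  have hle : l ≤ E.G K := by nlinarith [E.δ_lt_one]
  rw [ContinuousWithinAt, tendsto_order]
  constructor
  · intro a ha
    filter_upwards [self_mem_nhdsWithin] with k hk
    exact ha.trans_le (E.G_antitoneOn hk E.maxWedge_mem hk.2)
  · intro a ha
    obtain ⟨_, ⟨k1, hk1, rfl⟩, hlt⟩ := exists_lt_of_csInf_lt hne (hle.trans_lt ha)
    filter_upwards [self_mem_nhdsWithin, mem_nhdsWithin_of_mem_nhds (lt_mem_nhds hk1.2)]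
      with k hk hk'
    exact (E.G_antitoneOn ⟨hk1.1, hk1.2.le⟩ hk (le_of_lt hk')).trans_lt hlt

theorem continuousOn_G (hK : 0 < E.maxWedge) : ContinuousOn E.G (Icc 0 E.maxWedge) := by
  intro k hk
  rcases eq_or_lt_of_le hk.1 with rfl | h0
  · exact E.continuousWithinAt_G_zero hK
  rcases eq_or_lt_of_le hk.2 with rfl | h1
  · exact E.continuousWithinAt_G_maxWedge hK
  · have h := E.G_concaveOn.continuousOn_interior
    rw [interior_Icc] at h
    exact ((h k ⟨h0, h1⟩).continuousAt (Ioo_mem_nhds h0 h1)).continuousWithinAt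

theorem continuousOn_H (hK : 0 < E.maxWedge) (s : Fin (n + 2)) :
    ContinuousOn (E.H s) (Icc 0 E.maxWedge) :=
  (((E.continuousOn_flow s).mono Icc_subset_Ici_self).add
    (continuousOn_const.mul (E.continuousOn_G hK))).congr fun _ hk => E.H_eq s hk

/-- Optimal continuation wedges exist. -/
theorem exists_G_eq (hK : 0 < E.maxWedge) {k : ℝ} (hk : k ≤ E.maxWedge) :
    ∃ κ : Fin (n + 2) → ℝ, (∀ r, κ r ∈ Icc 0 E.maxWedge) ∧ k ≤ E.reward κ ∧
      E.G k = ∑ r, E.prob r * E.H r (κ r) := by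
  let B : Set (Fin (n + 2) → ℝ) := univ.pi fun _ => Icc 0 E.maxWedge
  have hB : IsCompact B := isCompact_univ_pi fun _ => isCompact_Icc
  have hBr : ContinuousOn E.reward B := E.continuousOn_reward.mono fun κ hκ r => (hκ r trivial).1
  have hcpt : IsCompact (B ∩ E.reward ⁻¹' Ici k) :=
    hB.of_isClosed_subset (hBr.preimage_isClosed_of_isClosed hB.isClosed isClosed_Ici)
      inter_subset_left
  have hcont : ContinuousOn (fun κ : Fin (n + 2) → ℝ => ∑ r, E.prob r * E.H r (κ r))
      (B ∩ E.reward ⁻¹' Ici k) := by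
    refine continuousOn_finsetSum _ fun r _ => continuousOn_const.mul ?_
    exact (E.continuousOn_H hK r).comp (continuous_apply r).continuousOn
      fun κ hκ => hκ.1 r trivial
  obtain ⟨κ, hκ, hmax⟩ := hcpt.exists_isMaxOn
    ⟨fun _ => E.maxWedge, fun _ _ => E.maxWedge_mem, hk.trans_eq E.reward_maxWedge.symm⟩ hcont
  refine ⟨κ, fun r => hκ.1 r trivial, hκ.2, le_antisymm ?_ (E.le_G (fun r => hκ.1 r trivial) hκ.2)⟩
  refine csSup_le (E.continuations_nonempty hk) ?_
  rintro v ⟨κ', hκ', hle, rfl⟩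
  exact hmax (show κ' ∈ _ from ⟨fun r _ => hκ' r, hle⟩)

/-! ### The Lagrangian and the optimal policies -/

/-- The planner's objective in state `r` when the promise to the old has the weight `m`. -/
noncomputable def objective (r : Fin (n + 2)) (m k : ℝ) : ℝ :=
  E.β / E.δ * m * E.W r k + (-k + E.δ * E.G k)

theorem H_eq_objective (r : Fin (n + 2)) {k : ℝ} (hk : k ∈ Icc 0 E.maxWedge) :
    E.H r k = E.logShare r + E.objective r 1 k := by
  rw [E.H_eq r hk, flow, objective]; ring

theorem continuousOn_objective (hK : 0 < E.maxWedge) (r : Fin (n + 2)) (m : ℝ) :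
    ContinuousOn (E.objective r m) (Icc 0 E.maxWedge) :=
  (continuousOn_const.mul ((E.continuousOn_W r).mono Icc_subset_Ici_self)).add
    (continuousOn_neg.add (continuousOn_const.mul (E.continuousOn_G hK)))

theorem concaveOn_neg_add_G : ConcaveOn ℝ (Icc 0 E.maxWedge) fun k => -k + E.δ * E.G k := by
  refine ⟨convex_Icc _ _, fun x hx y hy a b ha hb hab => ?_⟩
  have h := mul_le_mul_of_nonneg_left (E.G_concaveOn.2 hx hy ha hb hab) E.δ_pos.le
  simp only [smul_eq_mul] at h ⊢
  linarith

theorem strictConcaveOn_objective (r : Fin (n + 2)) {m : ℝ} (hm : 0 < m) :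
    StrictConcaveOn ℝ (Icc 0 E.maxWedge) (E.objective r m) := by
  refine StrictConcaveOn.add_concaveOn ?_ E.concaveOn_neg_add_G
  refine ⟨convex_Icc _ _, fun x hx y hy hxy a b ha hb hab => ?_⟩
  have h := mul_lt_mul_of_pos_left ((E.W_strictConcaveOn r).2 hx.1 hy.1 hxy ha hb hab)
    (mul_pos (div_pos E.β_pos E.δ_pos) hm)
  simp only [smul_eq_mul] at h ⊢
  linarith

open Classical in
/-- The optimal wedge in state `r` when the promise to the old has the weight `m`. -/
noncomputable def policy (r : Fin (n + 2)) (m : ℝ) : ℝ :=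
  if h : ∃ k ∈ Icc 0 E.maxWedge, IsMaxOn (E.objective r m) (Icc 0 E.maxWedge) k then h.choose
  else 0

theorem policy_spec (hK : 0 < E.maxWedge) (r : Fin (n + 2)) (m : ℝ) :
    E.policy r m ∈ Icc 0 E.maxWedge ∧
      IsMaxOn (E.objective r m) (Icc 0 E.maxWedge) (E.policy r m) := by
  have h : ∃ k ∈ Icc 0 E.maxWedge, IsMaxOn (E.objective r m) (Icc 0 E.maxWedge) k :=
    isCompact_Icc.exists_isMaxOn ⟨0, le_rfl, hK.le⟩ (E.continuousOn_objective hK r m)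
  rw [policy, dif_pos h]
  exact h.choose_spec

theorem policy_mem (hK : 0 < E.maxWedge) (r : Fin (n + 2)) (m : ℝ) :
    E.policy r m ∈ Icc 0 E.maxWedge := (E.policy_spec hK r m).1

theorem objective_le_policy (hK : 0 < E.maxWedge) (r : Fin (n + 2)) (m : ℝ) {k : ℝ}
    (hk : k ∈ Icc 0 E.maxWedge) : E.objective r m k ≤ E.objective r m (E.policy r m) :=
  (E.policy_spec hK r m).2 hk

theorem eq_policy (hK : 0 < E.maxWedge) (r : Fin (n + 2)) {m k : ℝ} (hm : 0 < m)
    (hk : k ∈ Icc 0 E.maxWedge) (h : E.objective r m (E.policy r m) ≤ E.objective r m k) :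
    k = E.policy r m :=
  (E.strictConcaveOn_objective r hm).eq_of_isMaxOn
    (fun _ hx => (E.objective_le_policy hK r m hx).trans h) (E.policy_spec hK r m).2 hk
    (E.policy_mem hK r m)

/-- Add the optimality inequalities at the two weights: `objective` has increasing differences in
weight and wedge. -/
theorem policy_mono (hK : 0 < E.maxWedge) (r : Fin (n + 2)) {m m' : ℝ} (h : m ≤ m') :
    E.policy r m ≤ E.policy r m' := by
  rcases eq_or_lt_of_le h with rfl | h
  · exact le_rfl
  have h1 := E.objective_le_policy hK r m (E.policy_mem hK r m')
  have h2 := E.objective_le_policy hK r m' (E.policy_mem hK r m)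
  by_contra hlt
  have h3 := E.W_strictMonoOn r (E.policy_mem hK r m').1 (E.policy_mem hK r m).1 (not_le.1 hlt)
  simp only [objective] at h1 h2
  have h4 := mul_pos (mul_pos (div_pos E.β_pos E.δ_pos) (sub_pos.2 h)) (sub_pos.2 h3)
  nlinarith

/-- Limit points of maximizers are maximizers, the range is compact, and for m > 0 strict concavity
makes the maximizer unique. -/
theorem continuousAt_policy (hK : 0 < E.maxWedge) (r : Fin (n + 2)) {m : ℝ} (hm : 0 < m) :
    ContinuousAt (E.policy r) m := by
  rw [ContinuousAt, tendsto_iff_ultrafilter]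
  intro g hg
  obtain ⟨k, hk, hle⟩ := isCompact_Icc.ultrafilter_le_nhds' (g.map (E.policy r))
    (Eventually.of_forall (f := (g : Filter ℝ)) fun m => E.policy_mem hK r m)
  have hlim : Tendsto (E.policy r) g (𝓝[Icc 0 E.maxWedge] k) :=
    tendsto_nhdsWithin_iff.2 ⟨hle, Eventually.of_forall fun m => E.policy_mem hK r m⟩
  have hid : Tendsto (fun m : ℝ => m) g (𝓝 m) := hg
  have h1 : Tendsto (fun m => E.objective r m (E.policy r m)) g (𝓝 (E.objective r m k)) := by
    refine ((hid.const_mul _).mul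
      (((E.continuousOn_W r).mono Icc_subset_Ici_self k hk).tendsto.comp hlim)).add ?_
    exact ((continuousOn_neg.add (continuousOn_const.mul (E.continuousOn_G hK))) k
      hk).tendsto.comp hlim
  have h2 : Tendsto (fun m' => E.objective r m' (E.policy r m)) g
      (𝓝 (E.objective r m (E.policy r m))) :=
    ((hid.const_mul _).mul_const _).add_const _
  have h3 := le_of_tendsto_of_tendsto' h2 h1 fun m' =>
    E.objective_le_policy hK r m' (E.policy_mem hK r m)
  rw [← E.eq_policy hK r hm hk h3]
  exact hle

/-- The wedge that the optimal policies with the weight `m` sustain. -/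
noncomputable def total (m : ℝ) : ℝ := E.reward fun r => E.policy r m

theorem total_mem (hK : 0 < E.maxWedge) (m : ℝ) : E.total m ∈ Icc 0 E.maxWedge :=
  ⟨E.reward_nonneg fun r => (E.policy_mem hK r m).1,
    E.reward_le_maxWedge fun r => E.policy_mem hK r m⟩

theorem total_mono (hK : 0 < E.maxWedge) {m m' : ℝ} (h : m ≤ m') : E.total m ≤ E.total m' :=
  E.reward_mono (fun r => (E.policy_mem hK r m).1) fun r => E.policy_mono hK r h

theorem policy_eq_of_total_eq (hK : 0 < E.maxWedge) {m m' : ℝ} (h : m ≤ m')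
    (he : E.total m = E.total m') (r : Fin (n + 2)) : E.policy r m = E.policy r m' :=
  E.eq_of_reward_le (fun r => (E.policy_mem hK r m).1) (fun r => E.policy_mono hK r h) he.ge r

theorem continuousAt_total (hK : 0 < E.maxWedge) {m : ℝ} (hm : 0 < m) :
    ContinuousAt E.total m := by
  have h : Tendsto (fun m r => E.policy r m) (𝓝 m) (𝓝[{κ | ∀ r, 0 ≤ κ r}] fun r => E.policy r m) :=
    tendsto_nhdsWithin_iff.2 ⟨tendsto_pi_nhds.2 fun r => E.continuousAt_policy hK r hm,
      Eventually.of_forall fun m r => (E.policy_mem hK r m).1⟩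
  exact (E.continuousOn_reward _ fun r => (E.policy_mem hK r m).1).tendsto.comp h

/-- The Lagrangian of the continuation problem. -/
noncomputable def lagrangian (m k : ℝ) : ℝ := E.δ * E.G k + (m - 1) * k

/-- With the multiplier m - 1 on the reward, the weight on each W r rises from 1 to m, and the
problem separates across states. -/
theorem sum_H_add (m : ℝ) {κ : Fin (n + 2) → ℝ} (hκ : ∀ r, κ r ∈ Icc 0 E.maxWedge) :
    E.δ * ∑ r, E.prob r * E.H r (κ r) + (m - 1) * E.reward κ =
      E.δ * ∑ r, E.prob r * (E.logShare r + E.objective r m (κ r)) -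
        (m - 1) * E.β * ∑ r, E.prob r * E.W r 0 := by
  have hδ := E.δ_pos.ne'
  simp only [reward, Finset.mul_sum, ← Finset.sum_add_distrib, ← Finset.sum_sub_distrib]
  refine Finset.sum_congr rfl fun r _ => ?_
  rw [E.H_eq_objective r (hκ r), objective, objective]
  field_simp
  ring

/-- Weak duality at wedges attaining `G k`. Equality forces them to be optimal state by state, hence
to be the policies; for m > 1 complementary slackness makes the reward constraint bind. -/
theorem lagrangian_le (hK : 0 < E.maxWedge) {m : ℝ} (hm : 1 ≤ m) {k : ℝ}
    (hk : k ∈ Icc 0 E.maxWedge) : E.lagrangian m k ≤ E.lagrangian m (E.total m) ∧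
      (E.lagrangian m (E.total m) ≤ E.lagrangian m k →
        k ≤ E.total m ∧ (1 < m → k = E.total m)) := by
  obtain ⟨κ, hκ, hle, hG⟩ := E.exists_G_eq hK hk.2
  have h1 := E.sum_H_add m hκ
  have h2 := E.sum_H_add m fun r => E.policy_mem hK r m
  have h3 : ∀ r, E.prob r * (E.logShare r + E.objective r m (κ r)) ≤
      E.prob r * (E.logShare r + E.objective r m (E.policy r m)) := fun r =>
    mul_le_mul_of_nonneg_left (by linarith [E.objective_le_policy hK r m (hκ r)]) (E.prob_pos r).le
  have h4 := mul_le_mul_of_nonneg_left (Finset.sum_le_sum fun r (_ : r ∈ Finset.univ) => h3 r)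
    E.δ_pos.le
  have h5 := mul_le_mul_of_nonneg_left
    (E.le_G (fun r => E.policy_mem hK r m) (le_refl (E.total m))) E.δ_pos.le
  have h6 := mul_le_mul_of_nonneg_left hle (sub_nonneg.2 hm)
  have h7 : E.reward (fun r => E.policy r m) = E.total m := rfl
  rw [h7] at h2
  simp only [lagrangian]
  rw [hG]
  refine ⟨by linarith, fun hge => ?_⟩
  have hpol : κ = fun r => E.policy r m := by
    funext r
    refine E.eq_policy hK r (by linarith) (hκ r) (not_lt.1 fun hlt => ?_)
    have h8 := mul_lt_mul_of_pos_left (Finset.sum_lt_sum (fun r (_ : r ∈ Finset.univ) => h3 r)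
      ⟨r, Finset.mem_univ r, mul_lt_mul_of_pos_left (add_lt_add_right hlt _) (E.prob_pos r)⟩)
      E.δ_pos
    linarith
  have hk' : k ≤ E.total m := by rw [hpol] at hle; exact hle
  refine ⟨hk', fun hm1 => le_antisymm hk' (le_of_mul_le_mul_left ?_ (sub_pos.2 hm1))⟩
  rw [hpol] at hge
  linarith

/-! ### Dynamics of the weights -/

/-- Ratio of the weights of the promises in a state with the wedge `k` and in the preceding
period. -/
noncomputable def growth (r : Fin (n + 2)) (k : ℝ) : ℝ := E.β / E.δ * odds (E.logShare r - k)

theorem growth_pos (r : Fin (n + 2)) {k : ℝ} (hk : 0 ≤ k) : 0 < E.growth r k :=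
  mul_pos (div_pos E.β_pos E.δ_pos) (odds_pos (E.logShare_sub_neg r hk))

theorem growth_strictAntiOn (r : Fin (n + 2)) : StrictAntiOn (E.growth r) (Ici 0) :=
  fun _ ha _ hb hab => mul_lt_mul_of_pos_left
    (odds_strictMonoOn (E.logShare_sub_neg r hb) (E.logShare_sub_neg r ha) (by linarith))
    (div_pos E.β_pos E.δ_pos)

theorem continuousOn_growth (r : Fin (n + 2)) : ContinuousOn (E.growth r) (Ici 0) :=
  continuousOn_const.mul (continuousOn_odds.comp (by fun_prop) fun _ hk => E.logShare_sub_neg r hk)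

theorem growth_lt_one_iff (r : Fin (n + 2)) {k : ℝ} (hk : 0 ≤ k) :
    E.growth r k < 1 ↔ E.logShare r - k < E.logStar := by
  rw [← odds_strictMonoOn.lt_iff_lt (E.logShare_sub_neg r hk) E.logStar_neg, odds_logStar, growth,
    ← lt_div_iff₀' (div_pos E.β_pos E.δ_pos), one_div_div]

theorem one_lt_growth_iff (r : Fin (n + 2)) {k : ℝ} (hk : 0 ≤ k) :
    1 < E.growth r k ↔ E.logStar < E.logShare r - k := by
  rw [← odds_strictMonoOn.lt_iff_lt E.logStar_neg (E.logShare_sub_neg r hk), odds_logStar, growth,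
    ← div_lt_iff₀' (div_pos E.β_pos E.δ_pos), one_div_div]

/-- The first-order condition in state r: linearizing the term in W at the optimum turns the
objective into the Lagrangian of `G` with the updated weight. -/
theorem lagrangian_le_policy (hK : 0 < E.maxWedge) (r : Fin (n + 2)) (m : ℝ) {k : ℝ}
    (hk : k ∈ Icc 0 E.maxWedge) :
    E.lagrangian (m * E.growth r (E.policy r m)) k ≤
      E.lagrangian (m * E.growth r (E.policy r m)) (E.policy r m) := by
  have hp := E.policy_mem hK r m
  have h := E.concaveOn_neg_add_G.add_deriv_mul_le
    ((E.hasDerivAt_W r hp.1).const_mul (E.β / E.δ * m)) hp hk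
    fun z hz => E.objective_le_policy hK r m hz
  simp only [lagrangian, growth]
  linarith

/-- The weight of the promises in the period that follows a period with the weight `m`, when the
state is `r`. -/
noncomputable def next (r : Fin (n + 2)) (m : ℝ) : ℝ := m * E.growth r (E.policy r m)

/-- `G` is nonincreasing, so a weight that supports a positive wedge against the wedge 0 has a
nonnegative multiplier. -/
theorem one_le_next (hK : 0 < E.maxWedge) {r : Fin (n + 2)} {m : ℝ} (hpos : 0 < E.policy r m) :
    1 ≤ E.next r m := by
  have hp := E.policy_mem hK r m
  have h0 : (0 : ℝ) ∈ Icc 0 E.maxWedge := ⟨le_rfl, hK.le⟩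
  have h := E.lagrangian_le_policy hK r m h0
  have hG := mul_le_mul_of_nonneg_left (E.G_antitoneOn h0 hp hp.1) E.δ_pos.le
  simp only [lagrangian, mul_zero, add_zero] at h
  by_contra hlt
  rw [next] at hlt
  nlinarith

theorem policy_le_total_next (hK : 0 < E.maxWedge) {r : Fin (n + 2)} {m : ℝ}
    (h1 : 1 ≤ E.next r m) :
    E.policy r m ≤ E.total (E.next r m) ∧
      (1 < E.next r m → E.policy r m = E.total (E.next r m)) :=
  (E.lagrangian_le hK h1 (E.policy_mem hK r m)).2
    (E.lagrangian_le_policy hK r m (E.total_mem hK _))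

theorem growth_zero_lt_one (hLow : E.LowestShareLe) {k : ℝ} (hk : 0 < k) : E.growth 0 k < 1 := by
  rw [E.growth_lt_one_iff 0 hk.le]
  linarith [E.logShare_zero_le hLow]

theorem one_lt_growth_last (hFB : E.FirstBestNotSustainable) :
    1 < E.growth (Fin.last (n + 1)) 0 := by
  rw [E.one_lt_growth_iff _ le_rfl, sub_zero]
  exact E.logShare_last_gt hFB

theorem policy_eq_maxWedge_of_total (hK : 0 < E.maxWedge) {m : ℝ} (h : E.total m = E.maxWedge)
    (r : Fin (n + 2)) : E.policy r m = E.maxWedge :=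
  E.eq_of_reward_le (κ' := fun _ => E.maxWedge) (fun r => (E.policy_mem hK r m).1)
    (fun r => (E.policy_mem hK r m).2) (E.reward_maxWedge.trans h.symm).le r

theorem policy_eq_zero_of_total (hK : 0 < E.maxWedge) {m : ℝ} (h : E.total m = 0)
    (r : Fin (n + 2)) : E.policy r m = 0 :=
  (E.eq_of_reward_le (κ := fun _ => 0) (fun _ => le_rfl) (fun r => (E.policy_mem hK r m).1)
    (h.trans E.reward_zero.symm).le r).symm

/-- Otherwise all policies equal K, and a run of lowest states keeps the total at K while
multiplying the weight by a fixed factor below 1. The weight would tend to 0, but it never falls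
below 1. -/
theorem total_lt_maxWedge (hK : 0 < E.maxWedge) (hLow : E.LowestShareLe) {m : ℝ} (hm : 1 ≤ m) :
    E.total m < E.maxWedge := by
  refine lt_of_le_of_ne (E.total_mem hK m).2 fun he => ?_
  set ρ := E.growth 0 E.maxWedge with hρ
  have hρ0 : 0 ≤ ρ := (E.growth_pos 0 hK.le).le
  have hind : ∀ j : ℕ, 1 ≤ m * ρ ^ j ∧ E.total (m * ρ ^ j) = E.maxWedge := by
    intro j
    induction j with
    | zero => simpa using ⟨hm, he⟩
    | succ j ih =>
      have hp := E.policy_eq_maxWedge_of_total hK ih.2 0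
      have hn : E.next 0 (m * ρ ^ j) = m * ρ ^ (j + 1) := by rw [next, hp, ← hρ]; ring
      have h1 := E.one_le_next hK (r := 0) (m := m * ρ ^ j) (by rw [hp]; exact hK)
      have h2 := (E.policy_le_total_next hK h1).1
      rw [hn] at h1 h2
      rw [hp] at h2
      exact ⟨h1, le_antisymm (E.total_mem hK _).2 h2⟩
  have ht : Tendsto (fun j : ℕ => m * ρ ^ j) atTop (𝓝 (m * 0)) :=
    (tendsto_pow_atTop_nhds_zero_of_lt_one hρ0 (E.growth_zero_lt_one hLow hK)).const_mul m
  have := ge_of_tendsto' ht fun j => (hind j).1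
  linarith

/-- For a large weight, the gain in W from moving up to K outweighs the bounded loss in the
remaining terms. -/
theorem tendsto_policy (hK : 0 < E.maxWedge) (r : Fin (n + 2)) :
    Tendsto (E.policy r) atTop (𝓝 E.maxWedge) := by
  rw [tendsto_order]
  refine ⟨fun a ha => ?_, fun a ha => Eventually.of_forall fun m =>
    (E.policy_mem hK r m).2.trans_lt ha⟩
  set k := max a 0
  have hkK : k < E.maxWedge := max_lt ha hK
  have hd := sub_pos.2 (E.W_strictMonoOn r (le_max_right a 0 : k ∈ Ici 0) hK.le hkK)
  set d := E.W r E.maxWedge - E.W r k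
  have hβδ := div_pos E.β_pos E.δ_pos
  have hlim : Tendsto (fun m => E.β / E.δ * m * d) atTop atTop :=
    (tendsto_id.const_mul_atTop hβδ).atTop_mul_const hd
  filter_upwards [hlim.eventually_gt_atTop
    (E.maxWedge + E.δ * (E.G 0 - E.G E.maxWedge)), eventually_gt_atTop 0] with m hm hm0
  by_contra hle
  have hp := E.policy_mem hK r m
  have hpk : E.policy r m ≤ k := (not_lt.1 hle).trans (le_max_left _ _)
  have h1 := E.objective_le_policy hK r m E.maxWedge_mem
  have h2 := mul_le_mul_of_nonneg_left (E.W_monotoneOn r hp.1 (le_max_right a 0 : k ∈ Ici 0) hpk)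
    (mul_pos hβδ hm0).le
  have h3 := mul_le_mul_of_nonneg_left (E.G_antitoneOn ⟨le_rfl, hK.le⟩ hp hp.1) E.δ_pos.le
  simp only [objective] at h1
  simp only [d] at hm
  linarith [hp.1]

theorem tendsto_total (hK : 0 < E.maxWedge) : Tendsto E.total atTop (𝓝 E.maxWedge) := by
  have h : Tendsto (fun m r => E.policy r m) atTop
      (𝓝[{κ | ∀ r, 0 ≤ κ r}] fun _ => E.maxWedge) :=
    tendsto_nhdsWithin_iff.2 ⟨tendsto_pi_nhds.2 fun r => E.tendsto_policy hK r,
      Eventually.of_forall fun m r => (E.policy_mem hK r m).1⟩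
  have := (E.continuousOn_reward (fun _ => E.maxWedge) fun _ => hK.le).tendsto.comp h
  rwa [E.reward_maxWedge] at this

/-- Otherwise all policies vanish, and a run of highest states keeps the total at 0 while the weight
grows geometrically; but the total tends to K as the weight tends to infinity. -/
theorem total_one_pos (hK : 0 < E.maxWedge) (hFB : E.FirstBestNotSustainable) :
    0 < E.total 1 := by
  refine lt_of_le_of_ne (E.total_mem hK 1).1 fun he => ?_
  set ρ := E.growth (Fin.last (n + 1)) 0 with hρ
  have hρ1 : 1 < ρ := E.one_lt_growth_last hFB
  have hind : ∀ j : ℕ, E.total (ρ ^ j) = 0 := by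
    intro j
    induction j with
    | zero => simpa using he.symm
    | succ j ih =>
      have hp := E.policy_eq_zero_of_total hK ih (Fin.last (n + 1))
      have hn : E.next (Fin.last (n + 1)) (ρ ^ j) = ρ ^ (j + 1) := by rw [next, hp, ← hρ, pow_succ]
      have h1 : 1 < E.next (Fin.last (n + 1)) (ρ ^ j) := by
        rw [hn]; exact one_lt_pow₀ hρ1 j.succ_ne_zero
      have h2 := (E.policy_le_total_next hK h1.le).2 h1
      rw [hn, hp] at h2
      exact h2.symm
  have ht := (E.tendsto_total hK).comp (tendsto_pow_atTop_atTop_of_one_lt hρ1)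
  have h0 : Tendsto (E.total ∘ fun j : ℕ => ρ ^ j) atTop (𝓝 0) := by
    have : (E.total ∘ fun j : ℕ => ρ ^ j) = fun _ => 0 := funext hind
    rw [this]; exact tendsto_const_nhds
  exact hK.ne' (tendsto_nhds_unique ht h0)

/-- A zero policy at weight 1 would lead to a weight above 1 with total 0, below the positive total
at weight 1. -/
theorem policy_pos (hK : 0 < E.maxWedge) (hFB : E.FirstBestNotSustainable) {s : Fin (n + 2)}
    (hs : 1 < E.growth s 0) {m : ℝ} (hm : 1 ≤ m) : 0 < E.policy s m := by
  refine lt_of_lt_of_le (lt_of_le_of_ne (E.policy_mem hK s 1).1 fun he => ?_)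
    (E.policy_mono hK s hm)
  have hn : E.next s 1 = E.growth s 0 := by rw [next, ← he, one_mul]
  have h1 : 1 < E.next s 1 := by rwa [hn]
  have h2 := (E.policy_le_total_next hK h1.le).2 h1
  have h3 := E.total_mono hK h1.le
  linarith [E.total_one_pos hK hFB]

theorem policy_lt_maxWedge (hK : 0 < E.maxWedge) (hLow : E.LowestShareLe) (r : Fin (n + 2))
    (m : ℝ) : E.policy r m < E.maxWedge := by
  refine lt_of_le_of_ne (E.policy_mem hK r m).2 fun he => ?_
  have h1 := E.one_le_next hK (r := r) (m := m) (by rwa [he])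
  have h2 := (E.policy_le_total_next hK h1).1
  linarith [E.total_lt_maxWedge hK hLow h1]

theorem policy_one_eq_zero (hK : 0 < E.maxWedge) {s : Fin (n + 2)} (hs : E.growth s 0 ≤ 1) :
    E.policy s 1 = 0 := by
  have hp := E.policy_mem hK s 1
  refine le_antisymm (not_lt.1 fun hpos => ?_) hp.1
  have h1 := E.one_le_next hK hpos
  rw [next, one_mul] at h1
  have := E.growth_strictAntiOn s (self_mem_Ici : (0 : ℝ) ∈ Ici 0) hp.1 hpos
  linarith

/-! ### Absence of flats -/

/-- The weights on which the sustained wedge stays constant up to the factor `R`. -/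
def flats (R : ℝ) : Set ℝ := {m | 1 ≤ m ∧ E.total m = E.total (R * m)}

variable {E}

theorem policy_eq_of_mem_flats (hK : 0 < E.maxWedge) {R m : ℝ} (hR : 1 < R) (hm : m ∈ E.flats R)
    (r : Fin (n + 2)) : E.policy r m = E.policy r (R * m) :=
  E.policy_eq_of_total_eq hK (by nlinarith [hm.1]) hm.2 r

/-- Policies at m and R m agree, so the growth factors agree and both weights are multiplied by the
same number. At the upper end the new weight exceeds 1, where the total equals the policy exactly;
monotonicity squeezes the lower end. -/
theorem next_mem_flats (hK : 0 < E.maxWedge) {R m : ℝ} (hR : 1 < R) (hm : m ∈ E.flats R)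
    {r : Fin (n + 2)} (hpos : 0 < E.policy r m) :
    E.next r m ∈ E.flats R ∧ E.total (E.next r m) = E.policy r m := by
  have h1 := E.one_le_next hK hpos
  have hp := policy_eq_of_mem_flats hK hR hm r
  have hn : E.next r (R * m) = R * E.next r m := by rw [next, ← hp, next]; ring
  have h2 : 1 < E.next r (R * m) := by rw [hn]; nlinarith
  have h3 := (E.policy_le_total_next hK h2.le).2 h2
  have h4 := (E.policy_le_total_next hK h1).1
  have h5 : E.total (E.next r m) ≤ E.total (R * E.next r m) := E.total_mono hK (by nlinarith)
  rw [hn, ← hp] at h3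
  exact ⟨⟨h1, by linarith⟩, by linarith⟩

/-- The least flat works: a positive wedge in the lowest state would carry it to a strictly smaller
one. -/
theorem exists_mem_flats_policy_eq_zero (hK : 0 < E.maxWedge) (hLow : E.LowestShareLe) {R : ℝ}
    (hR : 1 < R) (hne : (E.flats R).Nonempty) : ∃ m ∈ E.flats R, E.policy 0 m = 0 := by
  have hcont : ContinuousOn (fun m => E.total m - E.total (R * m)) (Ici 1) := fun m hm => by
    have hm : 0 < m := zero_lt_one.trans_le hm
    have h2 : ContinuousAt (fun m => E.total (R * m)) m :=
      ContinuousAt.comp (f := fun m => R * m) (E.continuousAt_total hK (by positivity))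
        (by fun_prop)
    exact ((E.continuousAt_total hK hm).sub h2).continuousWithinAt
  have hcl : IsClosed (E.flats R) := by
    have := hcont.preimage_isClosed_of_isClosed isClosed_Ici (isClosed_singleton (x := (0 : ℝ)))
    convert this using 1
    ext m
    simp [flats, sub_eq_zero]
  have hbdd : BddBelow (E.flats R) := ⟨1, fun m hm => hm.1⟩
  have hmem := hcl.csInf_mem hne hbdd
  refine ⟨_, hmem, le_antisymm (not_lt.1 fun hpos => ?_) (E.policy_mem hK _ _).1⟩
  have h1 := (next_mem_flats hK hR hmem hpos).1
  have h2 := csInf_le hbdd h1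
  have h3 := E.growth_zero_lt_one hLow hpos
  have h4 := hmem.1
  rw [next] at h2
  nlinarith

/-- Each ratio is realized at a weight m ≤ M, by a flat with zero wedge in the lowest state. Its
total is then at most `total M` < K, which bounds R m and hence R; the pairs (m, R) to be considered
form a compact set. -/
theorem exists_maximal_flats (hK : 0 < E.maxWedge) (hLow : E.LowestShareLe) {R₀ : ℝ}
    (hR₀ : 1 < R₀) (hne : (E.flats R₀).Nonempty) :
    ∃ R, 1 < R ∧ (E.flats R).Nonempty ∧ ∀ R', R < R' → E.flats R' = ∅ := by
  obtain ⟨M, hM1, hM⟩ : ∃ M, 1 ≤ M ∧ ∀ m, E.policy 0 m = 0 → m ≤ M := by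
    obtain ⟨M, hM⟩ := eventually_atTop.1 ((E.tendsto_policy hK 0).eventually (lt_mem_nhds hK))
    refine ⟨max 1 M, le_max_left _ _, fun m hm => not_lt.1 fun hlt => ?_⟩
    exact (hM m ((le_max_right _ _).trans hlt.le)).ne' hm
  have hmem : ∀ R, 1 < R → (E.flats R).Nonempty → ∃ m ∈ E.flats R, m ≤ M := fun R hR hne => by
    obtain ⟨m, hm, h0⟩ := exists_mem_flats_policy_eq_zero hK hLow hR hne
    exact ⟨m, hm, hM m h0⟩
  obtain ⟨L, hL⟩ := eventually_atTop.1 ((E.tendsto_total hK).eventually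
    (lt_mem_nhds (E.total_lt_maxWedge hK hLow hM1)))
  have hRL : ∀ R m, 1 < R → m ∈ E.flats R → m ≤ M → R ≤ L := fun R m hR hm hmM => by
    by_contra hlt
    have h1 := hL (R * m) (by nlinarith [hm.1])
    have h2 := E.total_mono hK hmM
    linarith [hm.2]
  let P : Set (ℝ × ℝ) := Icc 1 M ×ˢ Icc R₀ L
  have hPc : IsCompact P := isCompact_Icc.prod isCompact_Icc
  have hcont : ContinuousOn (fun p : ℝ × ℝ => E.total p.1 - E.total (p.2 * p.1)) P := by
    rintro ⟨m, R⟩ ⟨hm, hR⟩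
    have hm : 0 < m := zero_lt_one.trans_le hm.1
    have hR : 0 < R := zero_lt_one.trans (hR₀.trans_le hR.1)
    refine (ContinuousAt.sub ?_ ?_).continuousWithinAt
    · exact ContinuousAt.comp (f := fun p : ℝ × ℝ => p.1) (E.continuousAt_total hK hm)
        continuousAt_fst
    · exact ContinuousAt.comp (f := fun p : ℝ × ℝ => p.2 * p.1)
        (E.continuousAt_total hK (mul_pos hR hm)) (by fun_prop)
  have hcpt : IsCompact (P ∩ (fun p : ℝ × ℝ => E.total p.1 - E.total (p.2 * p.1)) ⁻¹' {0}) :=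
    hPc.of_isClosed_subset
      (hcont.preimage_isClosed_of_isClosed hPc.isClosed isClosed_singleton) inter_subset_left
  have hin : ∀ R m, R₀ ≤ R → m ∈ E.flats R → m ≤ M → (m, R) ∈
      P ∩ (fun p : ℝ × ℝ => E.total p.1 - E.total (p.2 * p.1)) ⁻¹' {0} := fun R m hR hm hmM =>
    ⟨⟨⟨hm.1, hmM⟩, hR, hRL R m (hR₀.trans_le hR) hm hmM⟩, sub_eq_zero.2 hm.2⟩
  obtain ⟨m₀, hm₀, hm₀M⟩ := hmem R₀ hR₀ hne
  obtain ⟨⟨m, R⟩, ⟨⟨hm, hR⟩, heq⟩, hmax⟩ := hcpt.exists_isMaxOn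
    ⟨_, hin R₀ m₀ le_rfl hm₀ hm₀M⟩ continuous_snd.continuousOn
  refine ⟨R, hR₀.trans_le hR.1, ⟨m, hm.1, sub_eq_zero.1 heq⟩, fun R' hR' => ?_⟩
  by_contra hne'
  have hR1 : R₀ ≤ R' := hR.1.trans hR'.le
  obtain ⟨m', hm', hmM'⟩ := hmem R' (hR₀.trans_le hR1) (nonempty_iff_ne_empty.2 hne')
  exact absurd (hmax (hin R' m' hR1 hm' hmM')) (not_le.2 hR')

theorem total_lt_of_mem_flats {R : ℝ} (hK : 0 < E.maxWedge) (hR : 1 < R)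
    (hmax : ∀ R', R < R' → E.flats R' = ∅) {m m' : ℝ} (hm : m ∈ E.flats R) (hm' : m' ∈ E.flats R)
    (hlt : m < m') : E.total m < E.total m' := by
  refine lt_of_le_of_ne (E.total_mono hK hlt.le) fun he => ?_
  have hm0 : 0 < m := zero_lt_one.trans_le hm.1
  -- Equal totals would merge the two flats into one from m to R m'.
  have h1 : R < R * m' / m := by rw [lt_div_iff₀ hm0]; nlinarith
  have h2 : m ∈ E.flats (R * m' / m) :=
    ⟨hm.1, by rw [div_mul_cancel₀ _ hm0.ne', he]; exact hm'.2⟩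
  rw [hmax _ h1] at h2
  exact h2

theorem mul_lt_of_mem_flats {R : ℝ} (hK : 0 < E.maxWedge) (hR : 1 < R)
    (hmax : ∀ R', R < R' → E.flats R' = ∅) {m m' : ℝ} (hm : m ∈ E.flats R) (hm' : m' ∈ E.flats R)
    (hlt : m < m') : R * m < m' := by
  by_contra hle
  have h1 := total_lt_of_mem_flats hK hR hmax hm hm' hlt
  have h2 := E.total_mono hK (not_lt.1 hle)
  linarith [hm.2]

theorem exists_least_of_subset_flats {R : ℝ} (hK : 0 < E.maxWedge) (hR : 1 < R)
    (hmax : ∀ R', R < R' → E.flats R' = ∅) {A : Set ℝ} (hA : A ⊆ E.flats R) (hne : A.Nonempty) :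
    ∃ m ∈ A, ∀ x ∈ A, m ≤ x := by
  have hbdd : BddBelow A := ⟨1, fun m hm => (hA hm).1⟩
  have h1 : 1 ≤ sInf A := le_csInf hne fun m hm => (hA hm).1
  -- An element within a factor R of the infimum is already the least one, because of the gaps
  -- between flats.
  obtain ⟨m, hm, hlt⟩ := exists_lt_of_csInf_lt hne (show sInf A < R * sInf A by nlinarith)
  refine ⟨m, hm, fun x hx => not_lt.1 fun hxm => ?_⟩
  have h2 := mul_lt_of_mem_flats hK hR hmax (hA hx) (hA hm) hxm
  have h3 := csInf_le hbdd hx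
  nlinarith

theorem exists_greatest_of_subset_flats {R : ℝ} (hK : 0 < E.maxWedge) (hR : 1 < R)
    (hmax : ∀ R', R < R' → E.flats R' = ∅) {A : Set ℝ} (hA : A ⊆ E.flats R) (hne : A.Nonempty)
    (hbdd : BddAbove A) : ∃ m ∈ A, ∀ x ∈ A, x ≤ m := by
  have h1 : 1 ≤ sSup A := by
    obtain ⟨x, hx⟩ := hne
    exact (hA hx).1.trans (le_csSup hbdd hx)
  obtain ⟨m, hm, hlt⟩ := exists_lt_of_lt_csSup hne
    (show sSup A / R < sSup A from div_lt_self (by linarith) hR)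
  refine ⟨m, hm, fun x hx => not_lt.1 fun hxm => ?_⟩
  have h2 := mul_lt_of_mem_flats hK hR hmax (hA hm) (hA hx) hxm
  have h3 := le_csSup hbdd hx
  rw [div_lt_iff₀ (by linarith)] at hlt
  nlinarith

theorem next_lt_next {R : ℝ} (hK : 0 < E.maxWedge) (hR : 1 < R) {r : Fin (n + 2)} {m m' : ℝ}
    (hm : m ∈ E.flats R) (hm' : m' ∈ E.flats R)
    (hpos : 0 < E.policy r m) (hlt : m < m') : E.next r m < E.next r m' := by
  rcases eq_or_lt_of_le (E.policy_mono hK r hlt.le) with he | hp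
  · rw [next, next, ← he]
    exact mul_lt_mul_of_pos_right hlt (E.growth_pos r hpos.le)
  · have hpos' := hpos.trans hp
    rw [← (next_mem_flats hK hR hm hpos).2, ← (next_mem_flats hK hR hm' hpos').2] at hp
    by_contra hle
    exact absurd (E.total_mono hK (not_lt.1 hle)) (not_le.2 hp)

theorem next_last_mem_flats {R : ℝ} (hK : 0 < E.maxWedge) (hR : 1 < R)
    (hFB : E.FirstBestNotSustainable) {m : ℝ} (hm : m ∈ E.flats R) :
    E.next (Fin.last (n + 1)) m ∈ E.flats R ∧
      E.total (E.next (Fin.last (n + 1)) m) = E.policy (Fin.last (n + 1)) m :=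
  next_mem_flats hK hR hm (E.policy_pos hK hFB (E.one_lt_growth_last hFB) hm.1)

theorem next_last_lt_next {R : ℝ} (hK : 0 < E.maxWedge) (hR : 1 < R)
    (hFB : E.FirstBestNotSustainable) {m m' : ℝ} (hm : m ∈ E.flats R) (hm' : m' ∈ E.flats R)
    (hlt : m < m') : E.next (Fin.last (n + 1)) m < E.next (Fin.last (n + 1)) m' :=
  next_lt_next hK hR hm hm' (E.policy_pos hK hFB (E.one_lt_growth_last hFB) hm.1) hlt

/-- The least flat moved down by the highest state would, by strict monotonicity of the move, be
sent to a smaller flat that is also moved down. -/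
theorem le_next_last {R : ℝ} (hK : 0 < E.maxWedge) (hR : 1 < R)
    (hmax : ∀ R', R < R' → E.flats R' = ∅) (hFB : E.FirstBestNotSustainable)
    {m : ℝ} (hm : m ∈ E.flats R) : m ≤ E.next (Fin.last (n + 1)) m := by
  by_contra hlt
  obtain ⟨x, ⟨hx, hxlt⟩, hleast⟩ := exists_least_of_subset_flats hK hR hmax
    (A := {x | x ∈ E.flats R ∧ E.next (Fin.last (n + 1)) x < x}) (fun x hx => hx.1)
    ⟨m, hm, not_le.1 hlt⟩
  have h1 := (next_last_mem_flats hK hR hFB hx).1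
  exact absurd (hleast _ ⟨h1, next_last_lt_next hK hR hFB h1 hx hxlt⟩) (not_le.2 hxlt)

theorem policy_of_next_last_eq {R : ℝ} (hK : 0 < E.maxWedge) {m : ℝ} (hm : m ∈ E.flats R)
    (he : E.next (Fin.last (n + 1)) m = m) :
    E.policy (Fin.last (n + 1)) m = E.starWedge (Fin.last (n + 1)) := by
  have hm0 : 0 < m := zero_lt_one.trans_le hm.1
  have hp := (E.policy_mem hK (Fin.last (n + 1)) m).1
  have hg : E.growth (Fin.last (n + 1)) (E.policy (Fin.last (n + 1)) m) = 1 := by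
    rw [next] at he
    exact mul_left_cancel₀ hm0.ne' (he.trans (mul_one m).symm)
  have h1 := (E.growth_lt_one_iff _ hp).not.1 hg.not_lt
  have h2 := (E.one_lt_growth_iff _ hp).not.1 hg.not_gt
  rw [starWedge, max_eq_right (by linarith)]
  linarith

theorem next_last_ne {R : ℝ} (hK : 0 < E.maxWedge) (hR : 1 < R)
    (hmax : ∀ R', R < R' → E.flats R' = ∅) (hFB : E.FirstBestNotSustainable)
    {m : ℝ} (hm : m ∈ E.flats R) : E.next (Fin.last (n + 1)) m ≠ m := by
  intro he
  have hm0 : 0 < m := zero_lt_one.trans_le hm.1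
  have htot : ∀ x ∈ E.flats R, E.next (Fin.last (n + 1)) x = x →
      E.total x = E.starWedge (Fin.last (n + 1)) := fun x hx hxe => by
    rw [← policy_of_next_last_eq hK hx hxe,
      ← (next_last_mem_flats hK hR hFB hx).2, hxe]
  -- At a fixed point the total is the first-best wedge of the highest state, which first-best
  -- wedges cannot sustain; so some state exceeds its first best.
  obtain ⟨r, hr⟩ : ∃ r, E.starWedge r < E.policy r m := by
    by_contra hcon
    push Not at hcon
    have h1 := E.reward_mono (fun r => (E.policy_mem hK r m).1) hcon
    have h2 := htot m hm he
    rw [total] at h2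
    linarith [E.reward_starWedge_lt hFB]
  have hpos := (E.starWedge_nonneg r).trans_lt hr
  have hg : E.growth r (E.policy r m) < 1 := by
    rw [E.growth_lt_one_iff r hpos.le]
    linarith [le_max_right 0 (E.logShare r - E.logStar), starWedge.eq_1 E r]
  have hlt : E.next r m < m := by rw [next]; nlinarith
  -- That state moves m down, so there are flats below m. The highest state preserves order and
  -- cannot lower x, so the flat x next below m is fixed too, with the same total as m: a
  -- contradiction.
  obtain ⟨x, ⟨hx, hxm⟩, hgr⟩ := exists_greatest_of_subset_flats hK hR hmax
    (A := {x | x ∈ E.flats R ∧ x < m}) (fun x hx => hx.1)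
    ⟨_, (next_mem_flats hK hR hm hpos).1, hlt⟩ ⟨m, fun x hx => hx.2.le⟩
  have h1 := next_last_lt_next hK hR hFB hx hm hxm
  rw [he] at h1
  have h2 := le_antisymm (hgr _ ⟨(next_last_mem_flats hK hR hFB hx).1, h1⟩)
    (le_next_last hK hR hmax hFB hx)
  have h3 := total_lt_of_mem_flats hK hR hmax hx hm hxm
  rw [htot m hm he, htot x hx h2] at h3
  exact lt_irrefl _ h3

theorem lt_next_last {R : ℝ} (hK : 0 < E.maxWedge) (hR : 1 < R)
    (hmax : ∀ R', R < R' → E.flats R' = ∅) (hFB : E.FirstBestNotSustainable)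
    {m : ℝ} (hm : m ∈ E.flats R) : m < E.next (Fin.last (n + 1)) m :=
  lt_of_le_of_ne (le_next_last hK hR hmax hFB hm) (next_last_ne hK hR hmax hFB hm).symm

theorem exists_mem_flats_gt {R : ℝ} (hK : 0 < E.maxWedge) (hR : 1 < R)
    (hmax : ∀ R', R < R' → E.flats R' = ∅) (hFB : E.FirstBestNotSustainable)
    (hne : (E.flats R).Nonempty) (B : ℝ) : ∃ m ∈ E.flats R, B < m := by
  by_contra hcon
  push Not at hcon
  obtain ⟨m, hm, hgr⟩ := exists_greatest_of_subset_flats hK hR hmax subset_rfl hne ⟨B, hcon⟩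
  exact absurd (hgr _ (next_last_mem_flats hK hR hFB hm).1)
    (not_le.2 (lt_next_last hK hR hmax hFB hm))

/-- The lowest and the highest state move the elements of a maximal family of flats in opposite
directions, and far out the two moves commute. This is incompatible with the strict monotonicity
of the growth factors. -/
theorem flats_eq_empty_of_maximal {R : ℝ} (hK : 0 < E.maxWedge) (hR : 1 < R)
    (hmax : ∀ R', R < R' → E.flats R' = ∅) (hFB : E.FirstBestNotSustainable)
    (hLow : E.LowestShareLe) : E.flats R = ∅ := by
  by_contra hne
  have htg : ∀ (r : Fin (n + 2)) {f : ℝ → ℝ}, Tendsto f atTop atTop →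
      Tendsto (fun m => E.growth r (E.policy r (f m))) atTop (𝓝 (E.growth r E.maxWedge)) :=
    fun r f hf => (E.continuousOn_growth r E.maxWedge hK.le).tendsto.comp
      (tendsto_nhdsWithin_iff.2 ⟨(E.tendsto_policy hK r).comp hf,
        Eventually.of_forall fun m => (E.policy_mem hK r _).1⟩)
  have hgpos : ∀ r, 0 < E.growth r E.maxWedge := fun r => E.growth_pos r hK.le
  have htn : ∀ r, Tendsto (E.next r) atTop atTop := fun r =>
    tendsto_id.atTop_mul_pos (hgpos r) (htg r tendsto_id)
  have hp := (htg (Fin.last (n + 1)) tendsto_id).mul (htg 0 (htn (Fin.last (n + 1))))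
  have hq := (htg (Fin.last (n + 1)) (htn 0)).mul (htg 0 tendsto_id)
  have hgg := mul_pos (hgpos (Fin.last (n + 1))) (hgpos 0)
  have hlt : E.growth (Fin.last (n + 1)) E.maxWedge * E.growth 0 E.maxWedge <
      R * (E.growth (Fin.last (n + 1)) E.maxWedge * E.growth 0 E.maxWedge) := by nlinarith
  -- Far out, both orders of the two moves multiply m by nearly the same number, so the results
  -- differ by less than the factor R.
  have hev := (hp.eventually_lt (hq.const_mul R) hlt).and
    ((hq.eventually_lt (hp.const_mul R) hlt).and
      (((E.tendsto_policy hK 0).eventually (lt_mem_nhds hK)).and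
        (((E.tendsto_policy hK 0).comp (htn (Fin.last (n + 1)))).eventually (lt_mem_nhds hK))))
  obtain ⟨B, hB⟩ := eventually_atTop.1 hev
  obtain ⟨m, hm, hBm⟩ :=
    exists_mem_flats_gt hK hR hmax hFB (nonempty_iff_ne_empty.2 hne) B
  obtain ⟨h1, h2, h3, h4⟩ := hB m hBm.le
  simp only [id, Function.comp] at h1 h2 h4
  have hm0 : 0 < m := zero_lt_one.trans_le hm.1
  obtain ⟨hI, htI⟩ := next_last_mem_flats hK hR hFB hm
  obtain ⟨h0, ht0⟩ := next_mem_flats hK hR hm h3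
  obtain ⟨hp, htp⟩ := next_mem_flats hK hR hI h4
  obtain ⟨hq, htq⟩ := next_last_mem_flats hK hR hFB h0
  have ep : E.next 0 (E.next (Fin.last (n + 1)) m) =
      m * (E.growth (Fin.last (n + 1)) (E.policy (Fin.last (n + 1)) m) *
        E.growth 0 (E.policy 0 (E.next (Fin.last (n + 1)) m))) := by
    rw [← mul_assoc]; rfl
  have eq : E.next (Fin.last (n + 1)) (E.next 0 m) =
      m * (E.growth (Fin.last (n + 1)) (E.policy (Fin.last (n + 1)) (E.next 0 m)) *
        E.growth 0 (E.policy 0 m)) := by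
    rw [mul_comm (E.growth _ _), ← mul_assoc]; rfl
  -- Distinct flats are more than a factor R apart, so the two moves commute exactly.
  have hpq : E.next 0 (E.next (Fin.last (n + 1)) m) =
      E.next (Fin.last (n + 1)) (E.next 0 m) := by
    rcases lt_trichotomy (E.next 0 (E.next (Fin.last (n + 1)) m))
      (E.next (Fin.last (n + 1)) (E.next 0 m)) with h | h | h
    · have := mul_lt_of_mem_flats hK hR hmax hp hq h
      rw [ep, eq] at this
      nlinarith
    · exact h
    · have := mul_lt_of_mem_flats hK hR hmax hq hp h
      rw [ep, eq] at this
      nlinarith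
  have hprod := mul_left_cancel₀ hm0.ne' (ep.symm.trans (hpq.trans eq))
  have hk : E.policy 0 (E.next (Fin.last (n + 1)) m) =
      E.policy (Fin.last (n + 1)) (E.next 0 m) := by rw [← htp, ← htq, hpq]
  rw [← hk] at hprod
  -- The wedge reached at the second step is common to both orders. It lies strictly above the
  -- first-step wedge of the lowest state and strictly below that of the highest, so both growth
  -- factors change in the same direction and the products cannot agree.
  have hlow : E.policy 0 m < E.policy 0 (E.next (Fin.last (n + 1)) m) := by
    rw [← ht0, hk, ← htq]
    exact total_lt_of_mem_flats hK hR hmax h0 hq (lt_next_last hK hR hmax hFB h0)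
  have hhigh : E.policy 0 (E.next (Fin.last (n + 1)) m) < E.policy (Fin.last (n + 1)) m := by
    rw [← htp, ← htI]
    refine total_lt_of_mem_flats hK hR hmax hp hI ?_
    have := E.growth_zero_lt_one hLow h4
    have h5 : 0 < E.next (Fin.last (n + 1)) m := zero_lt_one.trans_le hI.1
    rw [next]
    nlinarith
  have hg0 := E.growth_strictAntiOn 0 h3.le h4.le hlow
  have hgI := E.growth_strictAntiOn (Fin.last (n + 1)) h4.le
    (E.policy_mem hK (Fin.last (n + 1)) m).1 hhigh
  have hgI0 := E.growth_pos (Fin.last (n + 1)) (E.policy_mem hK (Fin.last (n + 1)) m).1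
  have hg00 := E.growth_pos 0 h4.le
  have := mul_lt_mul hgI hg0.le hg00 (hgI0.trans hgI).le
  linarith

theorem total_strictMonoOn (hK : 0 < E.maxWedge) (hLow : E.LowestShareLe)
    (hFB : E.FirstBestNotSustainable) : StrictMonoOn E.total (Ici 1) := by
  intro m hm m' _ hlt
  refine lt_of_le_of_ne (E.total_mono hK hlt.le) fun he => ?_
  have hm0 : 0 < m := zero_lt_one.trans_le hm
  obtain ⟨R, hR, hne, hmax⟩ := exists_maximal_flats hK hLow (R₀ := m' / m)
    ((one_lt_div hm0).2 hlt) ⟨m, hm, by rwa [div_mul_cancel₀ _ hm0.ne']⟩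
  exact hne.ne_empty (flats_eq_empty_of_maximal hK hR hmax hFB hLow)

end Economy

/-! ### Differentiability from supergradients -/

/-- A function with a continuous selection of supergradients is differentiable. -/
theorem hasDerivWithinAt_of_supergradient {S T : Set ℝ} {g v : ℝ → ℝ} {x : ℝ} (hx : x ∈ T)
    (hT : T ∈ 𝓝[S] x) (hTS : T ⊆ S) (hv : ContinuousOn v T)
    (h : ∀ y ∈ T, ∀ z ∈ S, g z ≤ g y + v y * (z - y)) : HasDerivWithinAt g (v x) S x := by
  have hv' : ContinuousWithinAt v S x := (hv x hx).mono_of_mem_nhdsWithin hT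
  rw [hasDerivWithinAt_iff_isLittleO, Asymptotics.isLittleO_iff]
  intro c hc
  filter_upwards [hT, Metric.continuousWithinAt_iff'.1 hv' c hc] with y hyT hy
  rw [Real.dist_eq] at hy
  have h1 := h x hx y (hTS hyT)
  have h2 := h y hyT x (hTS hx)
  rw [Real.norm_eq_abs, Real.norm_eq_abs, smul_eq_mul]
  calc |g y - g x - (y - x) * v x| ≤ |(v y - v x) * (y - x)| :=
        -- The supergradient inequalities at x and at y bound the remainder on both sides.
        abs_le_abs_of_nonpos (by linarith) (by linarith)
    _ = |v y - v x| * |y - x| := abs_mul _ _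
    _ ≤ c * |y - x| := mul_le_mul_of_nonneg_right hy.le (abs_nonneg _)

theorem exists_tendsto_neg_mul {a b c : ℝ} (hab : a < b) (hc : 0 < c) {v : ℝ → ℝ}
    (hv : AntitoneOn v (Ioo a b)) (h0 : ∀ x ∈ Ioo a b, v x ≤ 0) :
    ∃ l : ℝ≥0∞, Tendsto (fun x => (v x : EReal)) (𝓝[<] b)
      (𝓝 (-((c : EReal) * (l : EReal)))) := by
  have hmono : MonotoneOn (fun x => ENNReal.ofReal (-v x)) (Ioo a b) := fun x hx y hy hxy =>
    ENNReal.ofReal_le_ofReal (neg_le_neg (hv hx hy hxy))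
  have ht := hmono.tendsto_nhdsWithin_Ioo_left (nonempty_Ioo.2 hab) (OrderTop.bddAbove _)
  set L := sSup ((fun x => ENNReal.ofReal (-v x)) '' Ioo a b)
  -- The monotone function -v has the left limit L, possibly infinite; dividing by c gives the
  -- multiplier.
  refine ⟨(ENNReal.ofReal c)⁻¹ * L, ?_⟩
  have e : (c : EReal) * (((ENNReal.ofReal c)⁻¹ * L : ℝ≥0∞) : EReal) = (L : EReal) := by
    have hc' : (c : EReal) = ((ENNReal.ofReal c : ℝ≥0∞) : EReal) := by
      rw [EReal.coe_ennreal_ofReal, max_eq_left hc.le]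
    rw [hc', ← EReal.coe_ennreal_mul, ← mul_assoc,
      ENNReal.mul_inv_cancel (ENNReal.ofReal_pos.2 hc).ne' ENNReal.ofReal_ne_top, one_mul]
  rw [e]
  refine Tendsto.congr' ?_ ((continuous_neg.comp continuous_coe_ennreal_ereal).tendsto L |>.comp ht)
  filter_upwards [Ioo_mem_nhdsLT hab] with x hx
  simp only [Function.comp_apply, EReal.coe_ennreal_ofReal]
  rw [max_eq_left (neg_nonneg.2 (h0 x hx)), EReal.coe_neg, neg_neg]

/-!
### Upper envelopes of strictly concave functions

For a strictly concave `f` on `[a, b]` with the maximizer `p`, the largest value of `f` on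
`[x, b]` is `f (max x p)`.
-/

section envelope

variable {f : ℝ → ℝ} {a b p : ℝ}

theorem StrictConcaveOn.strictAntiOn_of_isMax (hf : StrictConcaveOn ℝ (Icc a b) f)
    (hp : p ∈ Icc a b) (hmax : ∀ x ∈ Icc a b, f x ≤ f p) : StrictAntiOn f (Icc p b) := by
  intro x hx y hy hxy
  have hy' : y ∈ Icc a b := ⟨hp.1.trans hy.1, hy.2⟩
  have hpy : f y < f p := by
    refine lt_of_le_of_ne (hmax y hy') fun he => ?_
    have := hf.eq_of_isMaxOn (fun z hz => (hmax z hz).trans he.ge) hmax hy' hp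
    linarith [hx.1]
  rcases eq_or_lt_of_le hx.1 with rfl | hpx
  · exact hpy
  have := hf.lt_on_openSegment hp hy' (by linarith)
    (by rw [openSegment_eq_Ioo (hpx.trans hxy)]; exact ⟨hpx, hxy⟩ : x ∈ openSegment ℝ p y)
  rwa [min_eq_right hpy.le] at this

theorem envelope_mem (hp : p ∈ Icc a b) {x : ℝ} (hx : x ∈ Icc a b) : max x p ∈ Icc a b :=
  ⟨hx.1.trans (le_max_left _ _), max_le hx.2 hp.2⟩

theorem envelope_ge (hf : StrictConcaveOn ℝ (Icc a b) f) (hp : p ∈ Icc a b)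
    (hmax : ∀ x ∈ Icc a b, f x ≤ f p) {x y : ℝ} (hxy : x ≤ y)
    (hy : y ∈ Icc a b) : f y ≤ f (max x p) := by
  rcases le_total x p with h | h
  · rw [max_eq_right h]; exact hmax y hy
  · rw [max_eq_left h]
    exact (hf.strictAntiOn_of_isMax hp hmax).antitoneOn ⟨h, hxy.trans hy.2⟩ ⟨h.trans hxy, hy.2⟩ hxy

theorem envelope_antitoneOn (hf : StrictConcaveOn ℝ (Icc a b) f) (hp : p ∈ Icc a b)
    (hmax : ∀ x ∈ Icc a b, f x ≤ f p) : AntitoneOn (fun x => f (max x p)) (Icc a b) :=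
  fun _ _ _ hy hxy => envelope_ge hf hp hmax (hxy.trans (le_max_left _ _)) (envelope_mem hp hy)

theorem envelope_concaveOn (hf : StrictConcaveOn ℝ (Icc a b) f) (hp : p ∈ Icc a b)
    (hmax : ∀ x ∈ Icc a b, f x ≤ f p) : ConcaveOn ℝ (Icc a b) (fun x => f (max x p)) := by
  refine ⟨convex_Icc a b, fun x hx y hy s t hs ht hst => ?_⟩
  have hx' := envelope_mem hp hx
  have hy' := envelope_mem hp hy
  refine (hf.concaveOn.2 hx' hy' hs ht hst).trans (envelope_ge hf hp hmax ?_
    (convex_Icc a b hx' hy' hs ht hst))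
  simp only [smul_eq_mul]
  gcongr <;> exact le_max_left _ _

theorem envelope_continuousOn (hc : ContinuousOn f (Icc a b)) (hp : p ∈ Icc a b) :
    ContinuousOn (fun x => f (max x p)) (Icc a b) :=
  hc.comp (by fun_prop) fun _ hx => envelope_mem hp hx

/-- A positive slope q at x means that x is not beyond the maximizer, where the envelope is flat;
hence the truncation at 0. -/
theorem envelope_supergradient (hf : StrictConcaveOn ℝ (Icc a b) f) (hp : p ∈ Icc a b)
    (hmax : ∀ x ∈ Icc a b, f x ≤ f p) {x q : ℝ} (hx : x ∈ Icc a b)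
    (hq : ∀ y ∈ Icc a b, f y ≤ f x + q * (y - x)) {y : ℝ} (hy : y ∈ Icc a b) :
    f (max y p) ≤ f (max x p) + min 0 q * (y - x) := by
  rcases le_total q 0 with h | h
  · rw [min_eq_right h]
    have h1 := hq _ (envelope_mem hp hy)
    have h2 := envelope_ge hf hp hmax le_rfl hx
    have h3 := mul_le_mul_of_nonpos_left (sub_le_sub_right (le_max_left y p) x) h
    linarith
  · rw [min_eq_left h, zero_mul, add_zero]
    have hle : f p ≤ f (max x p) := by
      rcases le_total x p with hxp | hxp
      · rw [max_eq_right hxp]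
      · rw [max_eq_left hxp]
        nlinarith [hq p hp]
    exact (hmax _ (envelope_mem hp hy)).trans hle

end envelope

/-! ### The supporting weight as a function of the wedge -/

namespace Economy

variable {n : ℕ} (E : Economy n)

/-- The weight that supports the wedge `k`. -/
noncomputable def weight (k : ℝ) : ℝ := sInf {m | 1 ≤ m ∧ k ≤ E.total m}

theorem weights_nonempty (hK : 0 < E.maxWedge) {k : ℝ} (hk : k < E.maxWedge) :
    {m | 1 ≤ m ∧ k ≤ E.total m}.Nonempty :=
  (((E.tendsto_total hK).eventually (lt_mem_nhds hk)).and (eventually_ge_atTop 1)).exists.imp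
    fun _ hm => ⟨hm.2, hm.1.le⟩

theorem bddBelow_weights (k : ℝ) : BddBelow {m | 1 ≤ m ∧ k ≤ E.total m} := ⟨1, fun _ hm => hm.1⟩

theorem weight_le {k m : ℝ} (hm : 1 ≤ m) (h : k ≤ E.total m) : E.weight k ≤ m :=
  csInf_le (E.bddBelow_weights k) ⟨hm, h⟩

theorem one_le_weight (hK : 0 < E.maxWedge) {k : ℝ} (hk : k < E.maxWedge) : 1 ≤ E.weight k :=
  le_csInf (E.weights_nonempty hK hk) fun _ hm => hm.1

theorem weight_mono (hK : 0 < E.maxWedge) {k k' : ℝ} (h : k ≤ k') (hk' : k' < E.maxWedge) :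
    E.weight k ≤ E.weight k' :=
  csInf_le_csInf (E.bddBelow_weights k) (E.weights_nonempty hK hk') fun _ hm =>
    ⟨hm.1, h.trans hm.2⟩

theorem le_total_weight (hK : 0 < E.maxWedge) {k : ℝ} (hk : k < E.maxWedge) :
    k ≤ E.total (E.weight k) := by
  have h1 := E.one_le_weight hK hk
  have hc := (E.continuousAt_total hK (zero_lt_one.trans_le h1)).tendsto.mono_left
    (nhdsWithin_le_nhds (s := Ioi (E.weight k)))
  refine ge_of_tendsto hc ?_
  filter_upwards [self_mem_nhdsWithin] with m hm
  obtain ⟨m', hm', hlt⟩ := exists_lt_of_csInf_lt (E.weights_nonempty hK hk) hm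
  exact hm'.2.trans (E.total_mono hK hlt.le)

theorem total_weight (hK : 0 < E.maxWedge) {k : ℝ} (hk : k < E.maxWedge)
    (h1 : 1 < E.weight k) : E.total (E.weight k) = k := by
  refine le_antisymm ?_ (E.le_total_weight hK hk)
  have hc := (E.continuousAt_total hK (zero_lt_one.trans h1)).tendsto.mono_left
    (nhdsWithin_le_nhds (s := Iio (E.weight k)))
  refine le_of_tendsto hc ?_
  filter_upwards [Ioo_mem_nhdsLT h1] with m hm
  by_contra hlt
  exact absurd (E.weight_le hm.1.le (not_le.1 hlt).le) (not_le.2 hm.2)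

/-- The weight is a generalized inverse of `total`; strict monotonicity of `total`, the absence of
flats, rules out jumps. -/
theorem continuousAt_weight (hK : 0 < E.maxWedge) (hLow : E.LowestShareLe)
    (hFB : E.FirstBestNotSustainable) {k : ℝ} (hk : k < E.maxWedge) :
    ContinuousAt E.weight k := by
  have h1 := E.one_le_weight hK hk
  have hmono := total_strictMonoOn hK hLow hFB
  rw [ContinuousAt, tendsto_order]
  constructor
  · intro a ha
    rcases lt_or_ge a 1 with ha1 | ha1
    · filter_upwards [gt_mem_nhds hk] with k' hk'
      exact ha1.trans_le (E.one_le_weight hK hk')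
    · have h2 := hmono ha1 h1 ha
      rw [E.total_weight hK hk (ha1.trans_lt ha)] at h2
      filter_upwards [gt_mem_nhds hk, lt_mem_nhds h2] with k' hk' hk2
      by_contra hle
      have h3 := E.total_mono hK (not_lt.1 hle)
      linarith [E.le_total_weight hK hk']
  · intro a ha
    obtain ⟨a', ha1, ha2⟩ := exists_between ha
    have h2 := (E.le_total_weight hK hk).trans_lt (hmono h1 (h1.trans ha1.le : 1 ≤ a') ha1)
    filter_upwards [gt_mem_nhds h2] with k' hk'
    exact (E.weight_le (h1.trans ha1.le) (le_of_lt hk')).trans_lt ha2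

/-- Thus 1 - `weight k` is a supergradient of δ `G` at k. At weight 1 the total may exceed k, but
then the multiplier is 0 and monotonicity of `G` suffices. -/
theorem lagrangian_le_weight (hK : 0 < E.maxWedge) {k k' : ℝ} (hk : k ∈ Ico 0 E.maxWedge)
    (hk' : k' ∈ Icc 0 E.maxWedge) :
    E.lagrangian (E.weight k) k' ≤ E.lagrangian (E.weight k) k := by
  have h1 := E.one_le_weight hK hk.2
  have h2 := (E.lagrangian_le hK h1 hk').1
  rcases eq_or_lt_of_le h1 with he | hlt
  · have h3 := E.le_total_weight hK hk.2
    have h4 := mul_le_mul_of_nonneg_left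
      (E.G_antitoneOn ⟨hk.1, hk.2.le⟩ (E.total_mem hK (E.weight k)) h3) E.δ_pos.le
    rw [← he] at h2 h4 ⊢
    simp only [lagrangian, sub_self, zero_mul, add_zero] at h2 ⊢
    exact h2.trans h4
  · rwa [E.total_weight hK hk.2 hlt] at h2

/-! ### The value function in terms of promises -/

/-- The wedge in state `s` that delivers the utility `ω` to the old. -/
noncomputable def wedgeOf (s : Fin (n + 2)) (ω : ℝ) : ℝ := E.logShare s - logCompl ω

theorem wedgeOf_W (s : Fin (n + 2)) {k : ℝ} (hk : 0 ≤ k) : E.wedgeOf s (E.W s k) = k := by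
  rw [wedgeOf, W, logCompl_logCompl (E.logShare_sub_neg s hk)]; ring

theorem W_wedgeOf (s : Fin (n + 2)) {ω : ℝ} (hω : ω < 0) : E.W s (E.wedgeOf s ω) = ω := by
  rw [W, wedgeOf, sub_sub_cancel, logCompl_logCompl hω]

theorem wedgeOf_strictMonoOn (s : Fin (n + 2)) : StrictMonoOn (E.wedgeOf s) (Iio 0) :=
  fun _ ha _ hb hab => sub_lt_sub_left (logCompl_strictAntiOn ha hb hab) _

theorem initialOld_eq {s : Fin (n + 2)} {c : Rule n} (hc : E.Sustainable s c) :
    initialOld s c = E.W s (E.wedge c 0 fun _ => s) :=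
  E.log_one_sub_eq c 0 _ (hc 0 _ rfl).1

theorem ωmax_eq (s : Fin (n + 2)) : E.ωmax s = E.W s E.maxWedge := by
  refine IsGreatest.csSup_eq ⟨⟨_, E.sustainable_constRule s, ?_⟩, ?_⟩
  · rw [E.initialOld_eq (E.sustainable_constRule s), wedge_constRule]
  · rintro ω ⟨c, hc, rfl⟩
    have h := hc.wedge_mem (t := 0) (h := fun _ => s) rfl
    rw [E.initialOld_eq hc]
    exact E.W_monotoneOn s h.1 E.maxWedge_nonneg h.2

theorem ωmin_lt_ωmax (hK : 0 < E.maxWedge) (s : Fin (n + 2)) : E.ωmin s < E.ωmax s := by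
  rw [ωmax_eq, ← W_zero]
  exact E.W_strictMonoOn s (self_mem_Ici : (0 : ℝ) ∈ Ici 0) hK.le hK

theorem ωmax_neg (s : Fin (n + 2)) : E.ωmax s < 0 := by
  rw [ωmax_eq]; exact E.W_neg s E.maxWedge_nonneg

theorem neg_of_mem_Ω {s : Fin (n + 2)} {ω : ℝ} (hω : ω ∈ E.Ω s) : ω < 0 :=
  hω.2.trans_lt (E.ωmax_neg s)

theorem W_mem_Ω (s : Fin (n + 2)) {k : ℝ} (hk : k ∈ Icc 0 E.maxWedge) : E.W s k ∈ E.Ω s := by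
  rw [Ω, ωmax_eq, ← W_zero]
  exact ⟨E.W_monotoneOn s (self_mem_Ici : (0 : ℝ) ∈ Ici 0) hk.1 hk.1,
    E.W_monotoneOn s hk.1 E.maxWedge_nonneg hk.2⟩

theorem wedgeOf_ωmin (s : Fin (n + 2)) : E.wedgeOf s (E.ωmin s) = 0 := by
  rw [← W_zero, wedgeOf_W _ _ le_rfl]

theorem wedgeOf_ωmax (s : Fin (n + 2)) : E.wedgeOf s (E.ωmax s) = E.maxWedge := by
  rw [ωmax_eq, wedgeOf_W _ _ E.maxWedge_nonneg]

theorem wedgeOf_mem {s : Fin (n + 2)} {ω : ℝ} (hω : ω ∈ E.Ω s) :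
    E.wedgeOf s ω ∈ Icc 0 E.maxWedge := by
  have hmono := (E.wedgeOf_strictMonoOn s).monotoneOn
  have h0 := E.neg_of_mem_Ω hω
  rw [← E.wedgeOf_ωmin s, ← E.wedgeOf_ωmax s]
  exact ⟨hmono (hω.1.trans_lt h0) h0 hω.1, hmono h0 (E.ωmax_neg s) hω.2⟩

theorem wedgeOf_lt {s : Fin (n + 2)} {ω : ℝ} (hω : ω ∈ Ico (E.ωmin s) (E.ωmax s)) :
    E.wedgeOf s ω < E.maxWedge := by
  rw [← E.wedgeOf_ωmax s]
  exact E.wedgeOf_strictMonoOn s (hω.2.trans (E.ωmax_neg s)) (E.ωmax_neg s) hω.2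

/-- The planner's payoff when the old receive exactly `ω`. -/
noncomputable def exactValue (s : Fin (n + 2)) (ω : ℝ) : ℝ := E.H s (E.wedgeOf s ω)

theorem exactValue_eq {s : Fin (n + 2)} {ω : ℝ} (hω : ω ∈ E.Ω s) :
    E.exactValue s ω = E.β / E.δ * ω + logCompl ω + E.δ * E.G (E.wedgeOf s ω) := by
  rw [exactValue, E.H_eq s (E.wedgeOf_mem hω), flow, E.W_wedgeOf s (E.neg_of_mem_Ω hω), wedgeOf]
  ring

/-- The promise that the planner would make freely. -/
noncomputable def peak (s : Fin (n + 2)) : ℝ := E.W s (E.policy s 1)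

theorem peak_mem (hK : 0 < E.maxWedge) (s : Fin (n + 2)) : E.peak s ∈ E.Ω s :=
  E.W_mem_Ω s (E.policy_mem hK s 1)

theorem wedgeOf_peak (hK : 0 < E.maxWedge) (s : Fin (n + 2)) :
    E.wedgeOf s (E.peak s) = E.policy s 1 := E.wedgeOf_W s (E.policy_mem hK s 1).1

theorem exactValue_le_peak (hK : 0 < E.maxWedge) (s : Fin (n + 2)) :
    ∀ ω ∈ E.Ω s, E.exactValue s ω ≤ E.exactValue s (E.peak s) := by
  intro ω hω
  rw [exactValue, exactValue, E.wedgeOf_peak hK, E.H_eq_objective s (E.wedgeOf_mem hω),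
    E.H_eq_objective s (E.policy_mem hK s 1)]
  exact add_le_add_right (E.objective_le_policy hK s 1 (E.wedgeOf_mem hω)) _

/-- The wedge is convex in the promise and `G` is nonincreasing and concave, so the composition is
concave; `logCompl` supplies strictness. -/
theorem exactValue_strictConcaveOn (s : Fin (n + 2)) :
    StrictConcaveOn ℝ (E.Ω s) (E.exactValue s) := by
  refine ⟨convex_Icc _ _, fun x hx y hy hxy a b ha hb hab => ?_⟩
  have hm : a • x + b • y ∈ E.Ω s := convex_Icc _ _ hx hy ha.le hb.le hab
  have hlc := logCompl_strictConcaveOn.2 (E.neg_of_mem_Ω hx) (E.neg_of_mem_Ω hy) hxy ha hb hab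
  have hwx := E.wedgeOf_mem hx
  have hwy := E.wedgeOf_mem hy
  have hG := E.G_concaveOn.2 hwx hwy ha.le hb.le hab
  have hle : E.wedgeOf s (a • x + b • y) ≤ a • E.wedgeOf s x + b • E.wedgeOf s y := by
    have e : E.logShare s = a * E.logShare s + b * E.logShare s := by
      rw [← add_mul, hab, one_mul]
    simp only [wedgeOf, smul_eq_mul] at hlc ⊢
    linarith
  have hG' := E.G_antitoneOn (E.wedgeOf_mem hm) (convex_Icc _ _ hwx hwy ha.le hb.le hab) hle
  have h := mul_le_mul_of_nonneg_left (hG.trans hG') E.δ_pos.le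
  rw [E.exactValue_eq hx, E.exactValue_eq hy, E.exactValue_eq hm]
  simp only [smul_eq_mul] at h hlc ⊢
  linarith

theorem continuousOn_wedgeOf (s : Fin (n + 2)) : ContinuousOn (E.wedgeOf s) (Iio 0) :=
  continuousOn_const.sub continuousOn_logCompl

theorem continuousOn_exactValue (hK : 0 < E.maxWedge) (s : Fin (n + 2)) :
    ContinuousOn (E.exactValue s) (E.Ω s) :=
  (E.continuousOn_H hK s).comp ((E.continuousOn_wedgeOf s).mono fun _ hω => E.neg_of_mem_Ω hω)
    fun _ hω => E.wedgeOf_mem hω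

/-- The planner exceeds the required promise exactly when it lies below the freely chosen one. -/
theorem V_eq (hK : 0 < E.maxWedge) {s : Fin (n + 2)} {ω : ℝ} (hω : ω ∈ E.Ω s) :
    E.V s ω = E.exactValue s (max ω (E.peak s)) := by
  have hp := E.peak_mem hK s
  have hm : max ω (E.peak s) ∈ E.Ω s := envelope_mem hp hω
  have hold : ∀ {c : Rule n}, E.Sustainable s c →
      initialOld s c ∈ E.Ω s ∧ E.wedgeOf s (initialOld s c) = E.wedge c 0 fun _ => s :=
    fun {c} hc => by
      have hw := hc.wedge_mem (t := 0) (h := fun _ => s) rfl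
      rw [E.initialOld_eq hc]
      exact ⟨E.W_mem_Ω s hw, E.wedgeOf_W s hw.1⟩
  have hsub : E.payoffs s (E.wedgeOf s (max ω (E.peak s))) ⊆
      {v | ∃ c : Rule n, E.Sustainable s c ∧ ω ≤ initialOld s c ∧ v = E.payoff s c} := by
    rintro v ⟨c, hc, hw, rfl⟩
    refine ⟨c, hc, ?_, rfl⟩
    rw [E.initialOld_eq hc, hw, E.W_wedgeOf s (E.neg_of_mem_Ω hm)]
    exact le_max_left _ _
  apply le_antisymm
  · refine csSup_le ((E.payoffs_nonempty s (E.wedgeOf_mem hm)).mono hsub) ?_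
    rintro v ⟨c, hc, hle, rfl⟩
    refine (E.payoff_le_H hc).trans ?_
    rw [← (hold hc).2]
    exact envelope_ge (E.exactValue_strictConcaveOn s) hp (E.exactValue_le_peak hK s) hle
      (hold hc).1
  · refine csSup_le_csSup ⟨0, ?_⟩ (E.payoffs_nonempty s (E.wedgeOf_mem hm)) hsub
    rintro v ⟨c, hc, -, rfl⟩
    exact E.payoff_nonpos hc

/-- Derivative of `exactValue`. -/
noncomputable def slopeOf (s : Fin (n + 2)) (ω : ℝ) : ℝ :=
  E.β / E.δ - odds ω * E.weight (E.wedgeOf s ω)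

/-- Combine the supergradient of `G` with the tangent of `logCompl`; the total coefficient of the
latter is the weight, which is nonnegative. -/
theorem exactValue_supergradient (hK : 0 < E.maxWedge) {s : Fin (n + 2)} {ω ω' : ℝ}
    (hω : ω ∈ Ico (E.ωmin s) (E.ωmax s)) (hω' : ω' ∈ E.Ω s) :
    E.exactValue s ω' ≤ E.exactValue s ω + E.slopeOf s ω * (ω' - ω) := by
  have hω1 : ω ∈ E.Ω s := Ico_subset_Icc_self hω
  have h1 := E.lagrangian_le_weight hK ⟨(E.wedgeOf_mem hω1).1, E.wedgeOf_lt hω⟩ (E.wedgeOf_mem hω')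
  have h2 := logCompl_le_tangent (E.neg_of_mem_Ω hω1) (E.neg_of_mem_Ω hω')
  have h3 := mul_le_mul_of_nonneg_left h2
    (zero_le_one.trans (E.one_le_weight hK (E.wedgeOf_lt hω)))
  rw [E.exactValue_eq hω1, E.exactValue_eq hω', slopeOf]
  simp only [lagrangian] at h1
  have e : E.wedgeOf s ω' = E.wedgeOf s ω + logCompl ω - logCompl ω' := by
    rw [wedgeOf, wedgeOf]; ring
  have e2 : (E.weight (E.wedgeOf s ω) - 1) * E.wedgeOf s ω' =
      (E.weight (E.wedgeOf s ω) - 1) * E.wedgeOf s ω +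
        (E.weight (E.wedgeOf s ω) - 1) * (logCompl ω - logCompl ω') := by
    conv_lhs => rw [e]
    ring
  linarith

theorem continuousOn_slopeOf (hK : 0 < E.maxWedge) (hLow : E.LowestShareLe)
    (hFB : E.FirstBestNotSustainable) (s : Fin (n + 2)) :
    ContinuousOn (E.slopeOf s) (Ico (E.ωmin s) (E.ωmax s)) := by
  have hneg : Ico (E.ωmin s) (E.ωmax s) ⊆ Iio 0 := fun ω hω => hω.2.trans (E.ωmax_neg s)
  refine continuousOn_const.sub ((continuousOn_odds.mono hneg).mul fun ω hω => ?_)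
  exact (E.continuousAt_weight hK hLow hFB (E.wedgeOf_lt hω)).comp_continuousWithinAt
    ((E.continuousOn_wedgeOf s).mono hneg ω hω)

theorem slopeOf_antitoneOn (hK : 0 < E.maxWedge) (s : Fin (n + 2)) :
    AntitoneOn (E.slopeOf s) (Ico (E.ωmin s) (E.ωmax s)) := by
  intro x hx y hy hxy
  have hx0 : x < 0 := hx.2.trans (E.ωmax_neg s)
  have hy0 : y < 0 := hy.2.trans (E.ωmax_neg s)
  have h1 := odds_strictMonoOn.monotoneOn hx0 hy0 hxy
  have h2 := E.weight_mono hK ((E.wedgeOf_strictMonoOn s).monotoneOn hx0 hy0 hxy) (E.wedgeOf_lt hy)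
  have h3 := E.one_le_weight hK (E.wedgeOf_lt hx)
  have := mul_le_mul h1 h2 (by linarith) (odds_pos hy0).le
  rw [slopeOf, slopeOf]
  linarith

theorem hasDerivWithinAt_V (hK : 0 < E.maxWedge) (hLow : E.LowestShareLe)
    (hFB : E.FirstBestNotSustainable) {s : Fin (n + 2)} {ω : ℝ}
    (hω : ω ∈ Ico (E.ωmin s) (E.ωmax s)) :
    HasDerivWithinAt (E.V s) (min 0 (E.slopeOf s ω)) (E.Ω s) ω := by
  refine hasDerivWithinAt_of_supergradient (v := fun ω => min 0 (E.slopeOf s ω)) hω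
    (mem_nhdsWithin.2 ⟨Iio (E.ωmax s), isOpen_Iio, hω.2, fun x hx => ⟨hx.2.1, hx.1⟩⟩)
    Ico_subset_Icc_self (continuousOn_const.inf (E.continuousOn_slopeOf hK hLow hFB s))
    fun x hx y hy => ?_
  rw [E.V_eq hK hy, E.V_eq hK (Ico_subset_Icc_self hx)]
  exact envelope_supergradient (E.exactValue_strictConcaveOn s) (E.peak_mem hK s)
    (E.exactValue_le_peak hK s) (Ico_subset_Icc_self hx)
    (fun z hz => E.exactValue_supergradient hK hx hz) hy

theorem Vω_eq (hK : 0 < E.maxWedge) (hLow : E.LowestShareLe)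
    (hFB : E.FirstBestNotSustainable) {s : Fin (n + 2)} {ω : ℝ}
    (hω : ω ∈ Ico (E.ωmin s) (E.ωmax s)) : E.Vω s ω = min 0 (E.slopeOf s ω) :=
  (E.hasDerivWithinAt_V hK hLow hFB hω).derivWithin
    (uniqueDiffOn_Icc (E.ωmin_lt_ωmax hK s) ω (Ico_subset_Icc_self hω))

theorem contDiffOn_V (hK : 0 < E.maxWedge) (hLow : E.LowestShareLe)
    (hFB : E.FirstBestNotSustainable) (s : Fin (n + 2)) :
    ContDiffOn ℝ 1 (E.V s) (Ico (E.ωmin s) (E.ωmax s)) := by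
  have hd : ∀ ω ∈ Ico (E.ωmin s) (E.ωmax s), HasDerivWithinAt (E.V s) (min 0 (E.slopeOf s ω))
      (Ico (E.ωmin s) (E.ωmax s)) ω := fun ω hω =>
    (E.hasDerivWithinAt_V hK hLow hFB hω).mono Ico_subset_Icc_self
  rw [contDiffOn_one_iff_derivWithin (uniqueDiffOn_Ico _ _)]
  refine ⟨fun ω hω => (hd ω hω).differentiableWithinAt,
    (continuousOn_const.inf (E.continuousOn_slopeOf hK hLow hFB s)).congr fun ω hω =>
      (hd ω hω).derivWithin (uniqueDiffOn_Ico _ _ ω hω)⟩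

/-! ### Properties of the peak and of the largest promise -/

/-- A wedge beyond the first best has growth factor below 1, but starting from weight 1 a positive
wedge leads to a weight of at least 1. -/
theorem policy_le_starWedge (hK : 0 < E.maxWedge) (s : Fin (n + 2)) :
    E.policy s 1 ≤ E.starWedge s := by
  have hp := E.policy_mem hK s 1
  by_contra hlt
  have hpos := (E.starWedge_nonneg s).trans_lt (not_le.1 hlt)
  have h1 := E.one_le_next hK hpos
  rw [next, one_mul] at h1
  refine absurd ((E.growth_lt_one_iff s hp.1).2 ?_) (not_lt.2 h1)
  have := le_max_right 0 (E.logShare s - E.logStar)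
  rw [starWedge] at hlt
  linarith

/-- Equality would keep the weight at 1, so policies bounded by first-best wedges would sustain the
first-best wedge of the highest state, against (c). -/
theorem policy_last_lt_starWedge (hK : 0 < E.maxWedge) (hFB : E.FirstBestNotSustainable) :
    E.policy (Fin.last (n + 1)) 1 < E.starWedge (Fin.last (n + 1)) := by
  refine lt_of_le_of_ne (E.policy_le_starWedge hK _) fun he => ?_
  have hpos := E.policy_pos hK hFB (E.one_lt_growth_last hFB) le_rfl
  have h1 := E.one_le_next hK hpos
  have h2 : E.next (Fin.last (n + 1)) 1 ≤ 1 := by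
    rw [next, one_mul]
    refine not_lt.1 fun hlt => ?_
    rw [E.one_lt_growth_iff _ hpos.le, he, logShare_sub_starWedge] at hlt
    exact absurd hlt (not_lt.2 (min_le_left _ _))
  have h3 := (E.policy_le_total_next hK h1).1
  rw [le_antisymm h2 h1] at h3
  have h4 := E.reward_mono (fun r => (E.policy_mem hK r 1).1) (E.policy_le_starWedge hK)
  have h5 := E.reward_starWedge_lt hFB
  rw [total] at h3
  linarith

theorem peak_le_ωstar (hK : 0 < E.maxWedge) (s : Fin (n + 2)) : E.peak s ≤ E.ωstar s := by
  rw [ωstar_eq]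
  exact E.W_monotoneOn s (E.policy_mem hK s 1).1 (E.starWedge_nonneg s) (E.policy_le_starWedge hK s)

theorem peak_last_lt_ωstar (hK : 0 < E.maxWedge) (hFB : E.FirstBestNotSustainable) :
    E.peak (Fin.last (n + 1)) < E.ωstar (Fin.last (n + 1)) := by
  rw [ωstar_eq]
  exact E.W_strictMonoOn _ (E.policy_mem hK _ 1).1 (E.starWedge_nonneg _)
    (E.policy_last_lt_starWedge hK hFB)

theorem peak_lt_ωmax (hK : 0 < E.maxWedge) (hLow : E.LowestShareLe) (s : Fin (n + 2)) :
    E.peak s < E.ωmax s := by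
  rw [ωmax_eq]
  exact E.W_strictMonoOn s (E.policy_mem hK s 1).1 hK.le (E.policy_lt_maxWedge hK hLow s 1)

theorem ωmin_lt_peak (hK : 0 < E.maxWedge) (hFB : E.FirstBestNotSustainable) {s : Fin (n + 2)}
    (hs : E.ωmin s < E.ωstar s) : E.ωmin s < E.peak s := by
  have hpos : 0 < E.starWedge s := by
    refine lt_of_le_of_ne (E.starWedge_nonneg s) fun he => ?_
    rw [ωstar_eq, ← he, W_zero] at hs
    exact lt_irrefl _ hs
  have hg : 1 < E.growth s 0 := by
    rw [E.one_lt_growth_iff s le_rfl, sub_zero]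
    by_contra hle
    rw [starWedge, max_eq_left (by linarith)] at hpos
    exact lt_irrefl _ hpos
  rw [← W_zero]
  exact E.W_strictMonoOn s (self_mem_Ici : (0 : ℝ) ∈ Ici 0) (E.policy_mem hK s 1).1
    (E.policy_pos hK hFB hg le_rfl)

theorem growth_zero_le_one {s : Fin (n + 2)} (hs : E.ωstar s = E.ωmin s) : E.growth s 0 ≤ 1 := by
  refine not_lt.1 fun hlt => ?_
  rw [E.one_lt_growth_iff s le_rfl, sub_zero] at hlt
  rw [ωstar_eq, ← W_zero] at hs
  have h := (E.W_strictMonoOn s).injOn (E.starWedge_nonneg s) (self_mem_Ici : (0 : ℝ) ∈ Ici 0) hs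
  rw [starWedge, max_eq_right (by linarith)] at h
  linarith

theorem peak_eq_ωmin (hK : 0 < E.maxWedge) {s : Fin (n + 2)} (hs : E.ωstar s = E.ωmin s) :
    E.peak s = E.ωmin s := by
  rw [peak, E.policy_one_eq_zero hK (E.growth_zero_le_one hs), W_zero]

theorem odds_ωmin (s : Fin (n + 2)) : odds (E.ωmin s) = (1 - E.share s) / E.share s := by
  rw [← W_zero, W, sub_zero, odds_logCompl (E.logShare_neg s), odds, exp_logShare, inv_div]

theorem Vω_ωmin_le (hK : 0 < E.maxWedge) (hLow : E.LowestShareLe)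
    (hFB : E.FirstBestNotSustainable) (s : Fin (n + 2)) :
    E.Vω s (E.ωmin s) ≤ E.β / E.δ - (1 - E.share s) / E.share s := by
  have hmem : E.ωmin s ∈ Ico (E.ωmin s) (E.ωmax s) := ⟨le_rfl, E.ωmin_lt_ωmax hK s⟩
  rw [E.Vω_eq hK hLow hFB hmem, slopeOf, odds_ωmin]
  have h1 := E.one_le_weight hK (E.wedgeOf_lt hmem)
  have h2 : 0 ≤ (1 - E.share s) / E.share s :=
    div_nonneg (by linarith [E.share_lt_one s]) (E.share_pos s).le
  exact (min_le_right _ _).trans (by nlinarith)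

theorem autarky_slope_nonpos {s : Fin (n + 2)} (hs : E.ωstar s = E.ωmin s) :
    E.β / E.δ - (1 - E.share s) / E.share s ≤ 0 := by
  have h := E.growth_zero_le_one hs
  rw [growth, sub_zero, ← le_div_iff₀ (odds_pos (E.logShare_neg s)), odds, exp_logShare,
    one_div_div] at h
  linarith

/-- V is constant up to the peak. Differentiability at the peak itself then forces the derivative to
vanish there too. -/
theorem Vω_eq_zero (hK : 0 < E.maxWedge) (hLow : E.LowestShareLe)
    (hFB : E.FirstBestNotSustainable) {s : Fin (n + 2)} (hs : E.ωmin s < E.peak s) {ω : ℝ}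
    (hω : ω ∈ Icc (E.ωmin s) (E.peak s)) : E.Vω s ω = 0 := by
  have hsub : Icc (E.ωmin s) (E.peak s) ⊆ E.Ω s := Icc_subset_Icc_right (E.peak_mem hK s).2
  have hω' : ω ∈ Ico (E.ωmin s) (E.ωmax s) := ⟨hω.1, hω.2.trans_lt (E.peak_lt_ωmax hK hLow s)⟩
  have h1 := (E.hasDerivWithinAt_V hK hLow hFB hω').mono hsub
  have h2 : HasDerivWithinAt (E.V s) 0 (Icc (E.ωmin s) (E.peak s)) ω := by
    have he : ∀ x ∈ Icc (E.ωmin s) (E.peak s), E.V s x = E.exactValue s (E.peak s) :=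
      fun x hx => by rw [E.V_eq hK (hsub hx), max_eq_right hx.2]
    exact (hasDerivWithinAt_const _ _ _).congr he (he ω hω)
  rw [E.Vω_eq hK hLow hFB hω']
  exact (uniqueDiffOn_Icc hs ω hω).eq_deriv _ h1 h2

theorem V_eqOn (hK : 0 < E.maxWedge) (s : Fin (n + 2)) :
    EqOn (E.exactValue s) (E.V s) (Icc (E.peak s) (E.ωmax s)) := fun ω hω => by
  rw [E.V_eq hK ⟨(E.peak_mem hK s).1.trans hω.1, hω.2⟩, max_eq_left hω.1]

theorem strictAntiOn_V (hK : 0 < E.maxWedge) (s : Fin (n + 2)) :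
    StrictAntiOn (E.V s) (Ioc (E.peak s) (E.ωmax s)) :=
  ((((E.exactValue_strictConcaveOn s).strictAntiOn_of_isMax (E.peak_mem hK s)
    (E.exactValue_le_peak hK s)).congr (E.V_eqOn hK s))).mono Ioc_subset_Icc_self

theorem strictConcaveOn_V (hK : 0 < E.maxWedge) (s : Fin (n + 2)) :
    StrictConcaveOn ℝ (Ioc (E.peak s) (E.ωmax s)) (E.V s) :=
  ((E.exactValue_strictConcaveOn s).subset
    (fun _ hω => ⟨(E.peak_mem hK s).1.trans hω.1.le, hω.2⟩) (convex_Ioc _ _)).congr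
    ((E.V_eqOn hK s).mono Ioc_subset_Icc_self)

theorem exists_tendsto_Vω (hK : 0 < E.maxWedge) (hLow : E.LowestShareLe)
    (hFB : E.FirstBestNotSustainable) (s : Fin (n + 2)) :
    ∃ lmax : ℝ≥0∞, Tendsto (fun ω => (E.Vω s ω : EReal)) (𝓝[<] (E.ωmax s))
      (𝓝 (-(((E.β / E.δ : ℝ) : EReal) * (lmax : EReal)))) := by
  refine exists_tendsto_neg_mul (E.ωmin_lt_ωmax hK s) (div_pos E.β_pos E.δ_pos)
    (fun x hx y hy hxy => ?_) fun x hx => ?_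
  · rw [E.Vω_eq hK hLow hFB (Ioo_subset_Ico_self hx), E.Vω_eq hK hLow hFB (Ioo_subset_Ico_self hy)]
    exact min_le_min_left 0
      (E.slopeOf_antitoneOn hK s (Ioo_subset_Ico_self hx) (Ioo_subset_Ico_self hy) hxy)
  · rw [E.Vω_eq hK hLow hFB (Ioo_subset_Ico_self hx)]
    exact min_le_left _ _

theorem ωmax_strictAnti : StrictAnti E.ωmax := fun s s' h => by
  rw [ωmax_eq, ωmax_eq]
  exact logCompl_strictAntiOn (E.logShare_sub_neg s E.maxWedge_nonneg)
    (E.logShare_sub_neg s' E.maxWedge_nonneg) (sub_lt_sub_right (E.logShare_strictMono h) _)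

/-- If the young consumed less in the higher state, its wedge would be larger but its next weight
smaller; wedges are totals at the next weights, which are monotone. -/
theorem peak_antitone (hK : 0 < E.maxWedge) :
    Antitone E.peak := by
  intro i j hij
  have hpi := E.policy_mem hK i 1
  have hpj := E.policy_mem hK j 1
  have hL := E.logShare_strictMono.monotone hij
  refine logCompl_strictAntiOn.antitoneOn (E.logShare_sub_neg i hpi.1)
    (E.logShare_sub_neg j hpj.1) (not_lt.1 fun hlt => ?_)
  have hlt' : E.policy i 1 < E.policy j 1 := by linarith
  have h1 := E.one_le_next hK (hpi.1.trans_lt hlt')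
  have hg : E.growth j (E.policy j 1) < E.growth i (E.policy i 1) :=
    mul_lt_mul_of_pos_left (odds_strictMonoOn (E.logShare_sub_neg j hpj.1)
      (E.logShare_sub_neg i hpi.1) hlt) (div_pos E.β_pos E.δ_pos)
  have hni : E.next j 1 < E.next i 1 := by simpa only [next, one_mul] using hg
  have h2 := (E.policy_le_total_next hK (h1.trans hni.le)).2 (h1.trans_lt hni)
  have h3 := (E.policy_le_total_next hK h1).1
  have h4 := E.total_mono hK hni.le
  linarith

/-- If no step were strict, the peak in the lowest state would be at most that in the highest, which
is below log(β/(β+δ)); by (b) this bound is at most the autarkic promise in the lowest state. -/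
theorem exists_peak_lt (hK : 0 < E.maxWedge) (hLow : E.LowestShareLe)
    (hFB : E.FirstBestNotSustainable) : ∃ i : Fin (n + 1), E.peak i.succ < E.peak i.castSucc := by
  by_contra hcon
  push Not at hcon
  have h1 := Fin.monotone_iff_le_succ.2 hcon (Fin.zero_le (Fin.last (n + 1)))
  have h2 := E.peak_last_lt_ωstar hK hFB
  rw [ωstar_eq, W, logShare_sub_starWedge, min_eq_left (E.logShare_last_gt hFB).le] at h2
  have h3 := logCompl_strictAntiOn.antitoneOn (E.logShare_neg 0) E.logStar_neg
    (E.logShare_zero_le hLow)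
  have h4 := (E.peak_mem hK 0).1
  rw [← W_zero, W, sub_zero] at h4
  linarith

theorem ωmin_lt_ωstar_last (hK : 0 < E.maxWedge) (hFB : E.FirstBestNotSustainable) :
    E.ωmin (Fin.last (n + 1)) < E.ωstar (Fin.last (n + 1)) :=
  (E.peak_mem hK _).1.trans_lt (E.peak_last_lt_ωstar hK hFB)

end Economy

theorem lemma1 {n : ℕ} (E : Economy n) (hQ : E.PerronRootGtOne) (hLow : E.LowestShareLe)
    (hFB : E.FirstBestNotSustainable) :
    -- (i)
    (∀ s, E.ωmin s < E.ωmax s ∧ AntitoneOn (E.V s) (E.Ω s) ∧ ConcaveOn ℝ (E.Ω s) (E.V s) ∧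
      ContinuousOn (E.V s) (E.Ω s) ∧ ContDiffOn ℝ 1 (E.V s) (Ico (E.ωmin s) (E.ωmax s))) ∧
    ∃ ω0 : Fin (n + 2) → ℝ,
      -- (ii)
      (∀ s, ω0 s ∈ Icc (E.ωmin s) (E.ωstar s) ∧ ω0 s < E.ωmax s ∧
        StrictAntiOn (E.V s) (Ioc (ω0 s) (E.ωmax s)) ∧
        StrictConcaveOn ℝ (Ioc (ω0 s) (E.ωmax s)) (E.V s) ∧
        (E.ωmin s < E.ωstar s →
          E.ωmin s < ω0 s ∧ ∀ ω ∈ Icc (E.ωmin s) (ω0 s), E.Vω s ω = 0) ∧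
        (E.ωstar s = E.ωmin s →
          ω0 s = E.ωstar s ∧
          E.Vω s (ω0 s) ≤ E.β / E.δ - (1 - E.share s) / E.share s ∧
          E.β / E.δ - (1 - E.share s) / E.share s ≤ 0) ∧
        ∃ lmax : ℝ≥0∞, Tendsto (fun ω => (E.Vω s ω : EReal)) (𝓝[<] (E.ωmax s))
          (𝓝 (-(((E.β / E.δ : ℝ) : EReal) * (lmax : EReal))))) ∧
      (∃ s, E.ωmin s < E.ωstar s ∧ ω0 s < E.ωstar s) ∧
      -- (iii)
      (∀ s, E.ωmax s < 0) ∧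
      (∀ i : Fin (n + 1), E.ωmax i.succ < E.ωmax i.castSucc) ∧
      (∀ i : Fin (n + 1), ω0 i.succ ≤ ω0 i.castSucc) ∧
      (∃ i : Fin (n + 1), ω0 i.succ < ω0 i.castSucc) := by
  have hK := E.maxWedge_pos hQ
  refine ⟨fun s => ⟨E.ωmin_lt_ωmax hK s, ?_, ?_, ?_, E.contDiffOn_V hK hLow hFB s⟩, E.peak,
    fun s => ⟨⟨(E.peak_mem hK s).1, E.peak_le_ωstar hK s⟩, E.peak_lt_ωmax hK hLow s,
      E.strictAntiOn_V hK s, E.strictConcaveOn_V hK s, fun hs => ?_, fun hs => ?_,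
      E.exists_tendsto_Vω hK hLow hFB s⟩,
    ⟨Fin.last (n + 1), E.ωmin_lt_ωstar_last hK hFB, E.peak_last_lt_ωstar hK hFB⟩,
    E.ωmax_neg, fun i => E.ωmax_strictAnti Fin.castSucc_lt_succ,
    fun i => E.peak_antitone hK Fin.castSucc_lt_succ.le, E.exists_peak_lt hK hLow hFB⟩
  · exact (envelope_antitoneOn (E.exactValue_strictConcaveOn s) (E.peak_mem hK s)
      (E.exactValue_le_peak hK s)).congr fun ω hω => (E.V_eq hK hω).symm
  · exact (envelope_concaveOn (E.exactValue_strictConcaveOn s) (E.peak_mem hK s)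
      (E.exactValue_le_peak hK s)).congr fun ω hω => (E.V_eq hK hω).symm
  · exact (envelope_continuousOn (E.continuousOn_exactValue hK s) (E.peak_mem hK s)).congr
      fun ω hω => E.V_eq hK hω
  · exact ⟨E.ωmin_lt_peak hK hFB hs, fun ω hω =>
      E.Vω_eq_zero hK hLow hFB (E.ωmin_lt_peak hK hFB hs) hω⟩
  · have hp := E.peak_eq_ωmin hK hs
    exact ⟨hp.trans hs.symm, hp ▸ E.Vω_ωmin_le hK hLow hFB s, E.autarky_slope_nonpos hs⟩
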